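/- Let $R=R_0\oplus R_1$ be a supercommutative ring (that is, an associative unital $\mathbb Z/2$-graded ring with $ab=(-1)^{|a||b|}ba$ for homogeneous $a,b$) in which $2$ is invertible, and let $V=V_0\oplus V_1$ be a free $R$-supermodule of dimension $p|q$, i.e. with a basis of $p$ even and $q$ odd vectors ($p,q\ge 0$). Put $va=(-1)^{|a||v|}av$ for homogeneous $a\in R$, $v\in V$, let $T(V)$ be the tensor algebra of the $R$-bimodule $V$, and let $$\Lambda(V)=\bigoplus_{k\ge 0}\Lambda^kV=T(V)\big/\big\langle v\otimes u+(-1)^{|v||u|}u\otimes v\;:\;v,u\in V\text{ homogeneous}\big\rangle$$ be the exterior algebra, with the $\mathbb Z/2$-grading inherited from $R$ and $V$. For an even (parity-preserving) $R$-linear operator $A:V\to V$ let $\Lambda^kA$ be the induced operator on $\Lambda^kV$ and put $c_k=c_k(A)=\operatorname{Tr}\Lambda^kA$ for $k\ge 0$ and $c_k=0$ for $k<0$, where $\operatorname{Tr}$ denotes the supertrace: $\operatorname{Tr}M=\operatorname{tr}M_{00}-\operatorname{tr}M_{11}$ for the matrix $M$ of an even operator in a homogeneous basis. Then all $c_k$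 lie in the commutative ring $R_0$, and for every integer $k>p-q$ $$\begin{vmatrix} c_k & c_{k+1} & \dots & c_{k+q}\\ c_{k+1} & c_{k+2} & \dots & c_{k+q+1}\\ \vdots & \vdots & & \vdots\\ c_{k+q} & c_{k+q+1} & \dots & c_{k+2q}\end{vmatrix}=0 .$$ -/

import Mathlib

/-!  Linear superalgebra over a supercommutative ring `R = R₀ ⊕ R₁`.

The `ZMod 2`-grading of `R` is a family `𝓡 : ZMod 2 → AddSubgroup R`, that of an `R`-supermodule
`V` a family `𝓥 : ZMod 2 → AddSubgroup V`. Supermodules are left modules; the right action is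
`v a = (-1)^(|a||v|) a v`, so a parity preserving map is left linear iff it is right linear. -/

namespace SuperLA

/-- The Koszul sign `(-1)^(i j)` of two parities. -/
def koszulSign (i j : ZMod 2) : ℤ := if i = 1 ∧ j = 1 then -1 else 1

/-- Supercommutativity: `a b = (-1)^(|a||b|) b a` for homogeneous `a`, `b`. -/
class SuperCommutative {R : Type*} [Ring R] (𝓡 : ZMod 2 → AddSubgroup R) : Prop where
  mul_comm' : ∀ {i j : ZMod 2} {a b : R}, a ∈ 𝓡 i → b ∈ 𝓡 j →
    a * b = koszulSign i j • (b * a)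

/-- The subring `R₀` of even elements. -/
def evenPart {R : Type*} [Ring R] (𝓡 : ZMod 2 → AddSubgroup R) [GradedRing 𝓡] : Subring R :=
  SetLike.GradeZero.subring 𝓡

instance {R : Type*} [Ring R] (𝓡 : ZMod 2 → AddSubgroup R) [GradedRing 𝓡]
    [SuperCommutative 𝓡] : CommRing (evenPart 𝓡) :=
  { (inferInstance : Ring (evenPart 𝓡)) with
    mul_comm := fun a b => Subtype.ext <| by
      have h := SuperCommutative.mul_comm' (𝓡 := 𝓡) (i := 0) (j := 0) a.2 b.2
      simpa [koszulSign] using h }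

section Supertrace

variable {R M : Type*} [Ring R] [AddCommGroup M] [Module R M]

/-- A basis consisting of `p` even and `q` odd vectors. -/
structure SuperBasis (R : Type*) {M : Type*} [Ring R] [AddCommGroup M] [Module R M]
    (𝓜 : ZMod 2 → AddSubgroup M) (p q : ℕ) where
  basis : Module.Basis (Fin p ⊕ Fin q) R M
  even_mem : ∀ i, basis (Sum.inl i) ∈ 𝓜 0
  odd_mem : ∀ j, basis (Sum.inr j) ∈ 𝓜 1

/-- `M` is a free supermodule of dimension `p|q`. -/
def HasSuperDim (R : Type*) {M : Type*} [Ring R] [AddCommGroup M] [Module R M]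
    (𝓜 : ZMod 2 → AddSubgroup M) (p q : ℕ) : Prop :=
  Nonempty (SuperBasis R 𝓜 p q)

/-- The supertrace `Tr M₀₀ - Tr M₁₁` of the matrix of `f` in a homogeneous basis. -/
noncomputable def SuperBasis.supertrace {𝓜 : ZMod 2 → AddSubgroup M} {p q : ℕ} (b : SuperBasis R 𝓜 p q)
    (f : M →ₗ[R] M) : R :=
  (∑ i, b.basis.repr (f (b.basis (Sum.inl i))) (Sum.inl i)) -
    ∑ j, b.basis.repr (f (b.basis (Sum.inr j))) (Sum.inr j)

open Classical in
/-- The supertrace of an (even) endomorphism of a free supermodule of finite dimension, computed in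
some homogeneous basis (and `0` by convention if there is none). -/
noncomputable def supertrace (𝓜 : ZMod 2 → AddSubgroup M) (f : M →ₗ[R] M) : R :=
  if h : ∃ m n : ℕ, HasSuperDim R 𝓜 m n then
    h.choose_spec.choose_spec.some.supertrace f
  else 0

end Supertrace

section Algebras

variable {R V : Type*} [Ring R] [AddCommGroup V] [Module R V]

/-- Relations presenting the tensor algebra of the `R`-bimodule `V`: the ring generated by the ring
`R` and the additive group `V`, in which multiplication of vectors by scalars on the left and on
the right is given by the bimodule structure of `V`. -/
inductive TensorRel (𝓡 : ZMod 2 → AddSubgroup R) (𝓥 : ZMod 2 → AddSubgroup V) :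
    FreeAlgebra ℤ (R ⊕ V) → FreeAlgebra ℤ (R ⊕ V) → Prop
  | scalar_one : TensorRel 𝓡 𝓥 (FreeAlgebra.ι ℤ (Sum.inl 1)) 1
  | scalar_add (a b : R) : TensorRel 𝓡 𝓥 (FreeAlgebra.ι ℤ (Sum.inl (a + b)))
      (FreeAlgebra.ι ℤ (Sum.inl a) + FreeAlgebra.ι ℤ (Sum.inl b))
  | scalar_mul (a b : R) : TensorRel 𝓡 𝓥 (FreeAlgebra.ι ℤ (Sum.inl (a * b)))
      (FreeAlgebra.ι ℤ (Sum.inl a) * FreeAlgebra.ι ℤ (Sum.inl b))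
  | vector_add (v w : V) : TensorRel 𝓡 𝓥 (FreeAlgebra.ι ℤ (Sum.inr (v + w)))
      (FreeAlgebra.ι ℤ (Sum.inr v) + FreeAlgebra.ι ℤ (Sum.inr w))
  | left_smul (a : R) (v : V) : TensorRel 𝓡 𝓥 (FreeAlgebra.ι ℤ (Sum.inr (a • v)))
      (FreeAlgebra.ι ℤ (Sum.inl a) * FreeAlgebra.ι ℤ (Sum.inr v))
  | right_smul {i j : ZMod 2} {a : R} {v : V} (ha : a ∈ 𝓡 i) (hv : v ∈ 𝓥 j) : TensorRel 𝓡 𝓥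
      (FreeAlgebra.ι ℤ (Sum.inr v) * FreeAlgebra.ι ℤ (Sum.inl a))
      (FreeAlgebra.ι ℤ (Sum.inr (koszulSign i j • a • v)))

/-- The tensor algebra `T(V)` over `R`. -/
def TensorAlg (𝓡 : ZMod 2 → AddSubgroup R) (𝓥 : ZMod 2 → AddSubgroup V) : Type _ :=
  RingQuot (TensorRel 𝓡 𝓥)

variable (𝓡 : ZMod 2 → AddSubgroup R) (𝓥 : ZMod 2 → AddSubgroup V)

noncomputable instance : Ring (TensorAlg 𝓡 𝓥) := inferInstanceAs (Ring (RingQuot _))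

/-- The canonical ring homomorphism from the free ring on `R ⊔ V`. -/
noncomputable def TensorAlg.mk : FreeAlgebra ℤ (R ⊕ V) →+* TensorAlg 𝓡 𝓥 :=
  RingQuot.mkRingHom _

/-- The canonical map `V → T(V)`. -/
noncomputable def TensorAlg.ι (v : V) : TensorAlg 𝓡 𝓥 :=
  TensorAlg.mk 𝓡 𝓥 (FreeAlgebra.ι ℤ (Sum.inr v))

/-- The canonical ring homomorphism `R → T(V)`. -/
noncomputable def TensorAlg.scalar : R →+* TensorAlg 𝓡 𝓥 :=
  RingHom.mk' { toFun := fun a => TensorAlg.mk 𝓡 𝓥 (FreeAlgebra.ι ℤ (Sum.inl a))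
                map_one' := (RingQuot.mkRingHom_rel TensorRel.scalar_one).trans (map_one _)
                map_mul' := fun a b =>
                  (RingQuot.mkRingHom_rel (TensorRel.scalar_mul a b)).trans (map_mul _ _ _) }
    fun a b => (RingQuot.mkRingHom_rel (TensorRel.scalar_add a b)).trans (map_add _ _ _)

/-- The relations `v ⊗ u + (-1)^(|v||u|) u ⊗ v = 0` for homogeneous `v`, `u`. -/
inductive ExteriorRel : TensorAlg 𝓡 𝓥 → TensorAlg 𝓡 𝓥 → Prop
  | anticomm {i j : ZMod 2} {v u : V} (hv : v ∈ 𝓥 i) (hu : u ∈ 𝓥 j) : ExteriorRel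
      (TensorAlg.ι 𝓡 𝓥 v * TensorAlg.ι 𝓡 𝓥 u +
        koszulSign i j • (TensorAlg.ι 𝓡 𝓥 u * TensorAlg.ι 𝓡 𝓥 v)) 0

/-- The exterior algebra `Λ(V)` of the supermodule `V` over `R`. -/
def ExteriorAlg : Type _ := RingQuot (ExteriorRel 𝓡 𝓥)

namespace ExteriorAlg

noncomputable instance : Ring (ExteriorAlg 𝓡 𝓥) := inferInstanceAs (Ring (RingQuot _))

/-- The quotient map `T(V) → Λ(V)`. -/
noncomputable def mk : TensorAlg 𝓡 𝓥 →+* ExteriorAlg 𝓡 𝓥 := RingQuot.mkRingHom _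

variable {𝓡 𝓥} in
theorem mk_rel {x y : TensorAlg 𝓡 𝓥} (h : ExteriorRel 𝓡 𝓥 x y) : mk 𝓡 𝓥 x = mk 𝓡 𝓥 y :=
  RingQuot.mkRingHom_rel h

/-- The canonical ring homomorphism `R → Λ(V)`. -/
noncomputable def scalar : R →+* ExteriorAlg 𝓡 𝓥 := (mk 𝓡 𝓥).comp (TensorAlg.scalar 𝓡 𝓥)

/-- The canonical map `V → Λ(V)`. -/
noncomputable def ι (v : V) : ExteriorAlg 𝓡 𝓥 := mk 𝓡 𝓥 (TensorAlg.ι 𝓡 𝓥 v)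

/-- `Λ(V)` is a left `R`-module. -/
noncomputable instance : Module R (ExteriorAlg 𝓡 𝓥) := Module.compHom _ (scalar 𝓡 𝓥)

/-- The product `v₁ ∧ ⋯ ∧ vₖ` in `Λ(V)`. -/
noncomputable def wedge {k : ℕ} (v : Fin k → V) : ExteriorAlg 𝓡 𝓥 :=
  (List.ofFn fun l => ι 𝓡 𝓥 (v l)).prod

/-- The parity grading of `Λ(V)` inherited from `V` (and `R`): `a v₁ ∧ ⋯ ∧ vₖ` has parity
`|a| + |v₁| + ⋯ + |vₖ|`. -/
noncomputable def parity (j : ZMod 2) : AddSubgroup (ExteriorAlg 𝓡 𝓥) :=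
  AddSubgroup.closure {x | ∃ (k : ℕ) (i : ZMod 2) (a : R) (d : Fin k → ZMod 2) (v : Fin k → V),
    a ∈ 𝓡 i ∧ (∀ l, v l ∈ 𝓥 (d l)) ∧ i + ∑ l, d l = j ∧ x = a • wedge 𝓡 𝓥 v}

/-- The exterior power `Λᵏ V`. -/
noncomputable def power (k : ℕ) : Submodule R (ExteriorAlg 𝓡 𝓥) :=
  Submodule.span R (Set.range fun v : Fin k → V => wedge 𝓡 𝓥 v)

/-- The parity grading of `Λᵏ V`. -/
noncomputable def powerParity (k : ℕ) (j : ZMod 2) : AddSubgroup (power 𝓡 𝓥 k) :=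
  (parity 𝓡 𝓥 j).comap (power 𝓡 𝓥 k).subtype.toAddMonoidHom

end ExteriorAlg

end Algebras

section Functoriality

variable {R V : Type*} [Ring R] [AddCommGroup V] [Module R V]

/-- Even (parity preserving) linear operators. -/
structure EvenOperator (R : Type*) {V : Type*} [Ring R] [AddCommGroup V] [Module R V]
    (𝓥 : ZMod 2 → AddSubgroup V) where
  toLin : V →ₗ[R] V
  map_mem : ∀ {i : ZMod 2} {v : V}, v ∈ 𝓥 i → toLin v ∈ 𝓥 i

variable (𝓡 : ZMod 2 → AddSubgroup R) {𝓥 : ZMod 2 → AddSubgroup V} (A : EvenOperator R 𝓥)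

/-- The map on free rings that fixes the generators from `R` and applies `A` to those from `V`. -/
noncomputable def freeMap : FreeAlgebra ℤ (R ⊕ V) →+* FreeAlgebra ℤ (R ⊕ V) :=
  (FreeAlgebra.lift ℤ fun x => FreeAlgebra.ι ℤ (Sum.map id A.toLin x)).toRingHom

@[simp] theorem freeMap_inl (a : R) :
    freeMap A (FreeAlgebra.ι ℤ (Sum.inl a)) = FreeAlgebra.ι ℤ (Sum.inl a) := by
  simp [freeMap]

@[simp] theorem freeMap_inr (v : V) :
    freeMap A (FreeAlgebra.ι ℤ (Sum.inr v)) = FreeAlgebra.ι ℤ (Sum.inr (A.toLin v)) := by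
  simp [freeMap]

theorem freeMap_rel {x y : FreeAlgebra ℤ (R ⊕ V)} (h : TensorRel 𝓡 𝓥 x y) :
    TensorRel 𝓡 𝓥 (freeMap A x) (freeMap A y) := by
  cases h with
  | scalar_one => simpa using TensorRel.scalar_one
  | scalar_add a b => simpa using TensorRel.scalar_add a b
  | scalar_mul a b => simpa using TensorRel.scalar_mul a b
  | vector_add v w => simpa using TensorRel.vector_add _ _
  | left_smul a v => simpa using TensorRel.left_smul _ _
  | right_smul ha hv => simpa using TensorRel.right_smul ha (A.map_mem hv)

/-- The ring endomorphism `T(A)` of `T(V)`. -/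
noncomputable def TensorAlg.map : TensorAlg 𝓡 𝓥 →+* TensorAlg 𝓡 𝓥 :=
  RingQuot.lift ⟨(TensorAlg.mk 𝓡 𝓥).comp (freeMap A), fun _ _ h =>
    RingQuot.mkRingHom_rel (freeMap_rel 𝓡 A h)⟩

theorem TensorAlg.map_mk (x : FreeAlgebra ℤ (R ⊕ V)) :
    TensorAlg.map 𝓡 A (TensorAlg.mk 𝓡 𝓥 x) = TensorAlg.mk 𝓡 𝓥 (freeMap A x) :=
  RingQuot.lift_mkRingHom_apply _ _ _

@[simp] theorem TensorAlg.map_ι (v : V) :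
    TensorAlg.map 𝓡 A (TensorAlg.ι 𝓡 𝓥 v) = TensorAlg.ι 𝓡 𝓥 (A.toLin v) := by
  simp [TensorAlg.ι, TensorAlg.map_mk]

@[simp] theorem TensorAlg.map_scalar (a : R) :
    TensorAlg.map 𝓡 A (TensorAlg.scalar 𝓡 𝓥 a) = TensorAlg.scalar 𝓡 𝓥 a := by
  change TensorAlg.map 𝓡 A (TensorAlg.mk 𝓡 𝓥 _) = TensorAlg.mk 𝓡 𝓥 _
  simp [TensorAlg.map_mk]

namespace ExteriorAlg

/-- The ring endomorphism `Λ(A)` of `Λ(V)`. -/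
noncomputable def map : ExteriorAlg 𝓡 𝓥 →+* ExteriorAlg 𝓡 𝓥 :=
  RingQuot.lift ⟨(mk 𝓡 𝓥).comp (TensorAlg.map 𝓡 A), fun x y h => by
    cases h with
    | anticomm hv hu =>
      have h := mk_rel (ExteriorRel.anticomm (𝓡 := 𝓡) (A.map_mem hv) (A.map_mem hu))
      simpa using h⟩

theorem map_mk (x : TensorAlg 𝓡 𝓥) : map 𝓡 A (mk 𝓡 𝓥 x) = mk 𝓡 𝓥 (TensorAlg.map 𝓡 A x) :=
  RingQuot.lift_mkRingHom_apply _ _ _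

@[simp] theorem map_ι (v : V) : map 𝓡 A (ι 𝓡 𝓥 v) = ι 𝓡 𝓥 (A.toLin v) := by
  simp [ι, map_mk]

@[simp] theorem map_scalar (a : R) : map 𝓡 A (scalar 𝓡 𝓥 a) = scalar 𝓡 𝓥 a := by
  simp [scalar, map_mk]

theorem map_wedge {k : ℕ} (v : Fin k → V) :
    map 𝓡 A (wedge 𝓡 𝓥 v) = wedge 𝓡 𝓥 (fun l => A.toLin (v l)) := by
  simp [wedge, map_list_prod, List.map_ofFn, Function.comp_def]

/-- `Λ(A)` as an `R`-linear map. -/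
noncomputable def mapLin : ExteriorAlg 𝓡 𝓥 →ₗ[R] ExteriorAlg 𝓡 𝓥 where
  toFun := map 𝓡 A
  map_add' := map_add _
  map_smul' a x := by
    change map 𝓡 A (scalar 𝓡 𝓥 a * x) = scalar 𝓡 𝓥 a * map 𝓡 A x
    simp

theorem mapLin_mem_power (k : ℕ) : ∀ x ∈ power 𝓡 𝓥 k, mapLin 𝓡 A x ∈ power 𝓡 𝓥 k := by
  intro x hx
  refine (Submodule.span_le (p := (power 𝓡 𝓥 k).comap (mapLin 𝓡 A))).2 ?_ hx
  rintro _ ⟨v, rfl⟩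
  exact Submodule.subset_span ⟨_, (map_wedge 𝓡 A v).symm⟩

/-- The operator `Λᵏ A` on `Λᵏ V`. -/
noncomputable def powerMap (k : ℕ) : power 𝓡 𝓥 k →ₗ[R] power 𝓡 𝓥 k :=
  (mapLin 𝓡 A).restrict (mapLin_mem_power 𝓡 A k)

end ExteriorAlg

/-- `c_k(A) = Tr Λᵏ A` for `k : ℤ`, which is `0` for `k < 0`. -/
noncomputable def exteriorTrace (k : ℤ) : R :=
  if 0 ≤ k then
    supertrace (ExteriorAlg.powerParity 𝓡 𝓥 k.toNat) (ExteriorAlg.powerMap 𝓡 A k.toNat)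
  else 0

end Functoriality

end SuperLA

namespace SuperLA

/-! Suppose first that `A` is diagonal in a homogeneous basis, with even eigenvalues. The sorted
monomials in the basis vectors, with no repeated even vector, form a basis of `Λᵏ V` on which `Λᵏ A`
is diagonal. An even eigenvector with eigenvalue `t` contributes the factor `1 + tX` to the
generating series of the `c_k`, and an odd one contributes `∑ (-t)ⁿ Xⁿ = (1 + tX)⁻¹`. The series is
therefore a quotient `N / D` with `deg N ≤ p`, `deg D ≤ q` and `D(0) = 1`. The coefficients of `D`
give a linear recurrence valid beyond degree `p`, hence a kernel vector of the Hankel matrix having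
an entry `1`, so the determinant vanishes (`hankel_det_eq_zero`).

A general `A` is reduced to this case by deformation. Its matrix `a` is replaced over `R[X]` by `a +
diag(X^e)` with distinct positive exponents `e`. In Laurent series in `X⁻¹` the diagonal poles
dominate, and their differences are invertible already over the integers. Eigenvectors are then
fixed points of a contraction for the adic topology (`exists_perturbed_eigenvector`), and they form
a homogeneous basis with even eigenvalues (`poleMatrix_diagonalizable`). So the determinant vanishes
in Laurent series, hence in `R[X]`, which embeds there, and finally over `R` on setting `X = 0`
(`hankel_det_traceSeq`).

The transport needs the trace of `Λᵏ A` to be an expression in the matrix of `A` that is natural in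
`R` (`supertrace_powerMap`, `map_matrixExteriorTrace`). This rests on the monomial basis of `Λᵏ V`.
Spanning comes from reordering words; independence comes from an action of `Λ(V)` on a free module
on monomials. Independence of the supertrace from the homogeneous basis (`basisSupertrace_eq`)
allows this basis to be used. -/

theorem koszulSign_add_right (i j k : ZMod 2) :
    koszulSign i (j + k) = koszulSign i j * koszulSign i k := by
  revert i j k; decide

theorem koszulSign_comm (i j : ZMod 2) : koszulSign i j = koszulSign j i := by
  revert i j; decide

@[simp] theorem koszulSign_zero_left (i : ZMod 2) : koszulSign 0 i = 1 := by
  revert i; decide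

@[simp] theorem koszulSign_zero_right (i : ZMod 2) : koszulSign i 0 = 1 := by
  revert i; decide

theorem parity_eq_zero_or_one (i : ZMod 2) : i = 0 ∨ i = 1 := by
  revert i; decide

theorem parity_add_self (i : ZMod 2) : i + i = 0 := CharTwo.add_self_eq_zero i

theorem parity_add_cancel (i j : ZMod 2) : i + j + j = i := by
  rw [add_assoc, parity_add_self, add_zero]

/-! ### Parity decompositions and the sign twist of scalars -/

section Twist

variable {R : Type*} [Ring R] (𝓡 : ZMod 2 → AddSubgroup R) [GradedRing 𝓡]

theorem eq_even_add_odd {M : Type*} [AddCommGroup M] (𝓜 : ZMod 2 → AddSubgroup M)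
    [DirectSum.Decomposition 𝓜] (a : M) :
    a = DirectSum.decompose 𝓜 a 0 + DirectSum.decompose 𝓜 a 1 := by
  classical
  conv_lhs => rw [← DirectSum.sum_support_decompose 𝓜 a]
  rw [Finset.sum_subset (Finset.subset_univ _) fun i _ hi => ?_]
  · exact Fin.sum_univ_two fun i : ZMod 2 => (DirectSum.decompose 𝓜 a i : M)
  · rw [DFinsupp.notMem_support_iff.1 hi, ZeroMemClass.coe_zero]

theorem exists_parity_decomposition {M : Type*} [AddCommGroup M] (𝓜 : ZMod 2 → AddSubgroup M)
    [DirectSum.Decomposition 𝓜] (j : ZMod 2) (a : M) :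
    ∃ b ∈ 𝓜 j, ∃ c ∈ 𝓜 (j + 1), a = b + c := by
  have h := eq_even_add_odd 𝓜 a
  obtain rfl | rfl := parity_eq_zero_or_one j
  · exact ⟨_, (DirectSum.decompose 𝓜 a 0).2, _, (DirectSum.decompose 𝓜 a 1).2, h⟩
  · exact ⟨_, (DirectSum.decompose 𝓜 a 1).2, _, (DirectSum.decompose 𝓜 a 0).2,
      h.trans (add_comm _ _)⟩

theorem eq_zero_of_mem_of_mem {M : Type*} [AddCommGroup M] (𝓜 : ZMod 2 → AddSubgroup M)
    [DirectSum.Decomposition 𝓜] {i j : ZMod 2} (hij : i ≠ j) {a : M} (hi : a ∈ 𝓜 i)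
    (hj : a ∈ 𝓜 j) : a = 0 := by
  rw [← DirectSum.decompose_of_mem_same 𝓜 hi, DirectSum.decompose_of_mem_ne 𝓜 hj hij.symm]

/-- The additive map multiplying elements of parity `j` by `(-1)^(i j)`. -/
noncomputable def twist (i : ZMod 2) : R →+ R where
  toFun a := ∑ j : ZMod 2, koszulSign i j • (DirectSum.decompose 𝓡 a j : R)
  map_zero' := by simp
  map_add' a b := by simp [smul_add, Finset.sum_add_distrib]

theorem twist_of_mem {i j : ZMod 2} {a : R} (ha : a ∈ 𝓡 j) :
    twist 𝓡 i a = koszulSign i j • a := by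
  change ∑ j : ZMod 2, koszulSign i j • (DirectSum.decompose 𝓡 a j : R) = _
  rw [Finset.sum_eq_single j]
  · rw [DirectSum.decompose_of_mem_same 𝓡 ha]
  · intro l _ hl
    rw [DirectSum.decompose_of_mem_ne 𝓡 ha hl.symm, smul_zero]
  · simp

theorem twist_mem {i j : ZMod 2} {a : R} (ha : a ∈ 𝓡 j) : twist 𝓡 i a ∈ 𝓡 j := by
  rw [twist_of_mem 𝓡 ha]
  exact zsmul_mem ha _

theorem twist_mul (i : ZMod 2) (a b : R) : twist 𝓡 i (a * b) = twist 𝓡 i a * twist 𝓡 i b := by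
  obtain ⟨a₀, ha₀, a₁, ha₁, rfl⟩ := exists_parity_decomposition 𝓡 0 a
  obtain ⟨b₀, hb₀, b₁, hb₁, rfl⟩ := exists_parity_decomposition 𝓡 0 b
  have key : ∀ {j k : ZMod 2} {x y : R}, x ∈ 𝓡 j → y ∈ 𝓡 k →
      twist 𝓡 i (x * y) = twist 𝓡 i x * twist 𝓡 i y := by
    intro j k x y hx hy
    rw [twist_of_mem 𝓡 hx, twist_of_mem 𝓡 hy,
      twist_of_mem 𝓡 (SetLike.GradedMul.mul_mem hx hy), koszulSign_add_right, smul_mul_smul_comm]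
  simp only [add_mul, mul_add, map_add, key ha₀ hb₀, key ha₀ hb₁, key ha₁ hb₀, key ha₁ hb₁]

theorem twist_twist_comm (i j : ZMod 2) (a : R) :
    twist 𝓡 i (twist 𝓡 j a) = twist 𝓡 j (twist 𝓡 i a) := by
  obtain ⟨a₀, ha₀, a₁, ha₁, rfl⟩ := exists_parity_decomposition 𝓡 0 a
  simp only [map_add]
  have key : ∀ {k : ZMod 2} {x : R}, x ∈ 𝓡 k →
      twist 𝓡 i (twist 𝓡 j x) = twist 𝓡 j (twist 𝓡 i x) := by
    intro k x hx
    rw [twist_of_mem 𝓡 hx, twist_of_mem 𝓡 hx, map_zsmul, map_zsmul, twist_of_mem 𝓡 hx,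
      twist_of_mem 𝓡 hx, smul_comm]
  rw [key ha₀, key ha₁]

theorem map_twist {S : Type*} [Ring S] (𝓢 : ZMod 2 → AddSubgroup S) [GradedRing 𝓢] (φ : R →+* S)
    (hφ : ∀ i, ∀ a ∈ 𝓡 i, φ a ∈ 𝓢 i) (i : ZMod 2) (a : R) :
    φ (twist 𝓡 i a) = twist 𝓢 i (φ a) := by
  obtain ⟨a₀, ha₀, a₁, ha₁, rfl⟩ := exists_parity_decomposition 𝓡 0 a
  simp only [map_add, twist_of_mem 𝓡 ha₀, twist_of_mem 𝓡 ha₁, twist_of_mem 𝓢 (hφ _ _ ha₀),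
    twist_of_mem 𝓢 (hφ _ _ ha₁), map_zsmul]

theorem supercommute {R : Type*} [Ring R] (𝓡 : ZMod 2 → AddSubgroup R) [SuperCommutative 𝓡]
    {i j : ZMod 2} {a b : R} (ha : a ∈ 𝓡 i) (hb : b ∈ 𝓡 j) :
    a * b = koszulSign i j • (b * a) :=
  SuperCommutative.mul_comm' ha hb

theorem even_mul_comm [SuperCommutative 𝓡] {a : R} (ha : a ∈ 𝓡 0) (b : R) : a * b = b * a := by
  obtain ⟨b₀, hb₀, b₁, hb₁, rfl⟩ := exists_parity_decomposition 𝓡 0 b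
  rw [mul_add, add_mul, supercommute 𝓡 ha hb₀, supercommute 𝓡 ha hb₁]
  simp

end Twist

/-! ### Homogeneous bases and invariance of the supertrace -/

section HomogBasis

variable {R M : Type*} [Ring R] [AddCommGroup M] [Module R M] (𝓡 : ZMod 2 → AddSubgroup R)

/-- `b` is a homogeneous basis with parities `π` of the supermodule `M`, whose homogeneous elements
are those with suitably homogeneous coordinates. -/
def IsHomogBasis {ι : Type*} (𝓜 : ZMod 2 → AddSubgroup M) (b : Module.Basis ι R M)
    (π : ι → ZMod 2) : Prop :=
  ∀ (j : ZMod 2) (v : M), v ∈ 𝓜 j ↔ ∀ x, b.repr v x ∈ 𝓡 (j + π x)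

variable {𝓡} {𝓜 : ZMod 2 → AddSubgroup M}

theorem IsHomogBasis.mem [GradedRing 𝓡] {ι : Type*} {b : Module.Basis ι R M} {π : ι → ZMod 2}
    (hb : IsHomogBasis 𝓡 𝓜 b π) (x : ι) : b x ∈ 𝓜 (π x) := by
  classical
  rw [hb]
  intro y
  rw [b.repr_self, Finsupp.single_apply]
  split_ifs with h
  · subst h
    rw [parity_add_self]
    exact SetLike.GradedOne.one_mem
  · exact zero_mem _

/-- Split every coordinate of `v ∈ 𝓜 j` into its expected and its wrong parity. The wrong parts
assemble to a vector of parity `j + 1` that is also a difference of two vectors of parity `j`, so it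
vanishes by `hdisj`. -/
theorem isHomogBasis_of_mem [GradedRing 𝓡] {ι : Type*} (b : Module.Basis ι R M)
    (π : ι → ZMod 2) (hb : ∀ x, b x ∈ 𝓜 (π x))
    (hsmul : ∀ (i j : ZMod 2) (a : R) (v : M), a ∈ 𝓡 i → v ∈ 𝓜 j → a • v ∈ 𝓜 (i + j))
    (hdisj : ∀ (j : ZMod 2) (v : M), v ∈ 𝓜 j → v ∈ 𝓜 (j + 1) → v = 0) :
    IsHomogBasis 𝓡 𝓜 b π := by
  intro j v
  have hmem : ∀ (j : ZMod 2) (r : ι →₀ R), (∀ x, r x ∈ 𝓡 (j + π x)) → b.repr.symm r ∈ 𝓜 j := by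
    intro j r hr
    rw [b.repr_symm_apply, Finsupp.linearCombination_apply]
    refine AddSubgroup.sum_mem _ fun x _ => ?_
    have h := hsmul _ _ _ _ (hr x) (hb x)
    rwa [parity_add_cancel] at h
  constructor
  · intro hv x
    choose f hf g hg hfg using fun x => exists_parity_decomposition 𝓡 (j + π x) (b.repr v x)
    -- Both parts of a zero coordinate vanish, so `f` and `g` are supported in the support of
    -- `b.repr v`.
    have hzero : ∀ x, b.repr v x = 0 → f x = 0 ∧ g x = 0 := by
      intro x hx
      have h0 : f x = - g x := eq_neg_of_add_eq_zero_left ((hfg x).symm.trans hx)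
      have hf0 : f x = 0 := by
        refine eq_zero_of_mem_of_mem 𝓡 (i := j + π x) (j := j + π x + 1) (by simp) (hf x) ?_
        rw [h0]
        exact neg_mem (hg x)
      exact ⟨hf0, by rw [hf0] at h0; exact neg_eq_zero.1 h0.symm⟩
    let F : ι →₀ R := Finsupp.onFinset (b.repr v).support f fun x hx => by
      rw [Finsupp.mem_support_iff]
      exact fun h => hx (hzero x h).1
    let G : ι →₀ R := Finsupp.onFinset (b.repr v).support g fun x hx => by
      rw [Finsupp.mem_support_iff]
      exact fun h => hx (hzero x h).2
    have hFG : b.repr v = F + G := Finsupp.ext fun x => hfg x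
    have hG : b.repr.symm G = v - b.repr.symm F := by
      rw [eq_sub_iff_add_eq, ← map_add, add_comm, ← hFG, LinearEquiv.symm_apply_apply]
    have hF : b.repr.symm F ∈ 𝓜 j := hmem j F hf
    have hG1 : b.repr.symm G ∈ 𝓜 (j + 1) := hmem _ G fun x => by
      have h := hg x
      rwa [add_right_comm] at h
    have hG0 : b.repr.symm G = 0 := hdisj j _ (hG ▸ sub_mem hv hF) hG1
    have hG2 : G = 0 := b.repr.symm.map_eq_zero_iff.1 hG0
    rw [hFG, hG2, add_zero]
    exact hf x
  · intro h
    have := hmem j (b.repr v) h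
    rwa [LinearEquiv.symm_apply_apply] at this

theorem IsHomogBasis.of_mem [GradedRing 𝓡] {ι κ : Type*} {b : Module.Basis ι R M}
    {π : ι → ZMod 2} (hb : IsHomogBasis 𝓡 𝓜 b π) (b' : Module.Basis κ R M) (π' : κ → ZMod 2)
    (hb' : ∀ x, b' x ∈ 𝓜 (π' x)) : IsHomogBasis 𝓡 𝓜 b' π' := by
  refine isHomogBasis_of_mem b' π' hb' ?_ ?_
  · intro i j a v ha hv
    rw [hb] at hv ⊢
    intro x
    have h := SetLike.GradedMul.mul_mem ha (hv x)
    rw [← add_assoc] at h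
    simpa using h
  · intro j v hv hv'
    rw [hb] at hv hv'
    refine b.repr.map_eq_zero_iff.1 (Finsupp.ext fun x => ?_)
    exact eq_zero_of_mem_of_mem 𝓡 (i := j + π x) (j := j + 1 + π x) (by simp) (hv x) (hv' x)

/-- The supertrace computed in a basis with parities `π`. -/
noncomputable def basisSupertrace {ι : Type*} [Fintype ι] (b : Module.Basis ι R M)
    (π : ι → ZMod 2) (f : M →ₗ[R] M) : R :=
  ∑ x, koszulSign (π x) (π x) • b.repr (f (b x)) x

theorem repr_map_eq_sum {N ι κ : Type*} [AddCommGroup N] [Module R N] [Fintype ι]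
    (b : Module.Basis ι R M) (b' : Module.Basis κ R N) (f : M →ₗ[R] N) (v : M) (y : κ) :
    b'.repr (f v) y = ∑ x, b.repr v x * b'.repr (f (b x)) y := by
  conv_lhs => rw [← b.sum_repr v]
  simp only [map_sum, map_smul, Finsupp.finsetSum_apply, Finsupp.smul_apply, smul_eq_mul]

/-- The super version of `tr (BC) = tr (CB)`: exchanging two matrix entries of parity `π x + π' y`
costs exactly the sign that turns the weight of `x` into the weight of `y`. -/
theorem basisSupertrace_eq [GradedRing 𝓡] [SuperCommutative 𝓡] {ι κ : Type*} [Fintype ι]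
    [Fintype κ] {b : Module.Basis ι R M} {π : ι → ZMod 2} {b' : Module.Basis κ R M}
    {π' : κ → ZMod 2} (hb : IsHomogBasis 𝓡 𝓜 b π) (hb' : IsHomogBasis 𝓡 𝓜 b' π')
    (f : M →ₗ[R] M) (hf : ∀ j, ∀ v ∈ 𝓜 j, f v ∈ 𝓜 j) :
    basisSupertrace b π f = basisSupertrace b' π' f := by
  unfold basisSupertrace
  have h1 : ∀ x, b.repr (f (b x)) x = ∑ y, b'.repr (f (b x)) y * b.repr (b' y) x :=
    fun x => repr_map_eq_sum b' b LinearMap.id _ _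
  have h2 : ∀ y, b'.repr (f (b' y)) y = ∑ x, b.repr (b' y) x * b'.repr (f (b x)) y :=
    fun y => repr_map_eq_sum b b' f _ _
  simp only [h1, h2, Finset.smul_sum]
  rw [Finset.sum_comm]
  refine Finset.sum_congr rfl fun y _ => Finset.sum_congr rfl fun x _ => ?_
  have m1 : b'.repr (f (b x)) y ∈ 𝓡 (π x + π' y) := (hb' _ _).1 (hf _ _ (hb.mem x)) y
  have m2 : b.repr (b' y) x ∈ 𝓡 (π' y + π x) := (hb _ _).1 (hb'.mem y) x
  rw [supercommute 𝓡 m1 m2, smul_smul]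
  congr 1
  generalize π x = i
  generalize π' y = j
  revert i j
  decide

theorem SuperBasis.isHomogBasis_basis [GradedRing 𝓡] {ι : Type*} {b : Module.Basis ι R M}
    {π : ι → ZMod 2} (hb : IsHomogBasis 𝓡 𝓜 b π) {m n : ℕ} (B : SuperBasis R 𝓜 m n) :
    IsHomogBasis 𝓡 𝓜 B.basis (Sum.elim (fun _ => 0) fun _ => 1) := by
  refine hb.of_mem _ _ ?_
  rintro (x | x)
  · exact B.even_mem x
  · exact B.odd_mem x

theorem SuperBasis.supertrace_eq_basisSupertrace {m n : ℕ} (B : SuperBasis R 𝓜 m n)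
    (f : M →ₗ[R] M) :
    B.supertrace f = basisSupertrace B.basis (Sum.elim (fun _ => 0) fun _ => 1) f := by
  have h11 : koszulSign 1 1 = -1 := by decide
  simp [SuperBasis.supertrace, basisSupertrace, Fintype.sum_sum_type, h11, sub_eq_add_neg]

theorem IsHomogBasis.exists_hasSuperDim [GradedRing 𝓡] {ι : Type*} [Fintype ι]
    {b : Module.Basis ι R M} {π : ι → ZMod 2} (hb : IsHomogBasis 𝓡 𝓜 b π) :
    ∃ m n : ℕ, HasSuperDim R 𝓜 m n := by
  classical
  let e : Fin (Fintype.card {x // π x = 0}) ⊕ Fin (Fintype.card {x // ¬ π x = 0}) ≃ ι :=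
    (Equiv.sumCongr (Fintype.equivFin _).symm (Fintype.equivFin _).symm).trans
      (Equiv.sumCompl fun x => π x = 0)
  refine ⟨_, _, ⟨⟨b.reindex e.symm, fun i => ?_, fun j => ?_⟩⟩⟩
  · have h := hb.mem (e (Sum.inl i))
    have h0 : π (e (Sum.inl i)) = 0 := ((Fintype.equivFin {x // π x = 0}).symm i).2
    rw [h0] at h
    simpa using h
  · have h := hb.mem (e (Sum.inr j))
    have h0 : π (e (Sum.inr j)) = 1 :=
      (by decide : ∀ a : ZMod 2, a ≠ 0 → a = 1) _ ((Fintype.equivFin {x // ¬ π x = 0}).symm j).2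
    rw [h0] at h
    simpa using h

/-- Frees `supertrace` from its arbitrary choice of basis, so that it can be computed in the basis
of monomials. -/
theorem IsHomogBasis.supertrace_eq [GradedRing 𝓡] [SuperCommutative 𝓡] {ι : Type*} [Fintype ι]
    {b : Module.Basis ι R M} {π : ι → ZMod 2} (hb : IsHomogBasis 𝓡 𝓜 b π)
    (f : M →ₗ[R] M) (hf : ∀ j, ∀ v ∈ 𝓜 j, f v ∈ 𝓜 j) :
    supertrace 𝓜 f = basisSupertrace b π f := by
  have h := hb.exists_hasSuperDim
  rw [supertrace, dif_pos h, SuperBasis.supertrace_eq_basisSupertrace]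
  exact basisSupertrace_eq (SuperBasis.isHomogBasis_basis hb _) hb f hf

theorem IsHomogBasis.basisSupertrace_mem [GradedRing 𝓡] {ι : Type*} [Fintype ι]
    {b : Module.Basis ι R M} {π : ι → ZMod 2} (hb : IsHomogBasis 𝓡 𝓜 b π)
    (f : M →ₗ[R] M) (hf : ∀ j, ∀ v ∈ 𝓜 j, f v ∈ 𝓜 j) : basisSupertrace b π f ∈ 𝓡 0 := by
  refine AddSubgroup.sum_mem _ fun x _ => zsmul_mem ?_ _
  have h := (hb _ _).1 (hf _ _ (hb.mem x)) x
  rwa [parity_add_self] at h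

end HomogBasis

/-! ### A free module on monomials carrying the exterior relations -/

section Model

variable {R ι : Type*} [Ring R] (𝓡 : ZMod 2 → AddSubgroup R) [GradedRing 𝓡] [Fintype ι]
  [LinearOrder ι] (π : ι → ZMod 2)

/-- The sign with which the generator `x` multiplies the monomial `m` in the exterior algebra,
`0` if the product vanishes. -/
def monomialSign (x : ι) (m : ι →₀ ℕ) : ℤ :=
  if π x = 0 ∧ m x ≠ 0 then 0
  else ∏ y with y < x, (-koszulSign (π x) (π y)) ^ m y

/-- The parity of a monomial. -/
def monomialParity (m : ι →₀ ℕ) : ZMod 2 := ∑ x, m x • π x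

omit [LinearOrder ι] in
theorem monomialParity_add_single (m : ι →₀ ℕ) (x : ι) :
    monomialParity π (m + Finsupp.single x 1) = monomialParity π m + π x := by
  classical
  simp [monomialParity, add_smul, Finset.sum_add_distrib, Finsupp.single_apply]

theorem prod_add_single (x y : ι) (m : ι →₀ ℕ) (f : ι → ℤ) :
    ∏ z with z < x, f z ^ (m + Finsupp.single y 1 : ι →₀ ℕ) z =
      (if y < x then f y else 1) * ∏ z with z < x, f z ^ m z := by
  simp only [Finsupp.add_apply, pow_add, Finset.prod_mul_distrib]
  rw [mul_comm]
  congr 1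
  split_ifs with h
  · rw [Finset.prod_eq_single y]
    · simp
    · intro z _ hz
      simp [hz.symm]
    · simp [h]
  · refine Finset.prod_eq_one fun z hz => ?_
    have hz' : y ≠ z := by
      rintro rfl
      exact h (Finset.mem_filter.1 hz).2
    simp [hz']

/-- For `x ≠ y` only the larger generator has to move past the smaller one, so just one of the two
orders acquires an extra factor `-koszulSign`. For `x = y` even both sides vanish, and for `x = y`
odd the factor is `1`. -/
theorem monomialSign_anticomm (x y : ι) (m : ι →₀ ℕ) :
    monomialSign π x (m + Finsupp.single y 1) * monomialSign π y m =
      -koszulSign (π x) (π y) *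
        (monomialSign π y (m + Finsupp.single x 1) * monomialSign π x m) := by
  have hpar : ∀ a : ZMod 2, a ≠ 0 → a = 1 := by decide
  rcases eq_or_ne x y with rfl | hxy
  · by_cases h : π x = 0
    · simp [monomialSign, h]
    · have h11 : -koszulSign (π x) (π x) = 1 := by rw [hpar _ h]; decide
      rw [h11, one_mul]
  · have e1 : (m + Finsupp.single y 1 : ι →₀ ℕ) x = m x := by simp [hxy.symm]
    have e2 : (m + Finsupp.single x 1 : ι →₀ ℕ) y = m y := by simp [hxy]
    simp only [monomialSign, e1, e2, prod_add_single]
    by_cases hx : π x = 0 ∧ m x ≠ 0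
    · simp [hx]
    by_cases hy : π y = 0 ∧ m y ≠ 0
    · simp [hy]
    simp only [hx, hy, if_false]
    have hsq : ∀ a b : ZMod 2, -koszulSign a b * -koszulSign b a = 1 := by decide
    rcases lt_or_gt_of_ne hxy with h | h
    · rw [if_neg (not_lt.2 h.le), if_pos h]
      linear_combination (-(∏ z with z < x, (-koszulSign (π x) (π z)) ^ m z) *
        ∏ z with z < y, (-koszulSign (π y) (π z)) ^ m z) * hsq (π x) (π y)
    · rw [if_neg (not_lt.2 h.le), if_pos h]
      ring

/-- Left multiplication by the generator `x` on the free module on monomials. -/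
noncomputable def genMul (x : ι) : Module.End ℤ ((ι →₀ ℕ) →₀ R) :=
  (Finsupp.liftAddHom fun m => (Finsupp.singleAddHom (m + Finsupp.single x 1)).comp
    (monomialSign π x m • twist 𝓡 (π x))).toIntLinearMap

theorem genMul_single (x : ι) (m : ι →₀ ℕ) (c : R) :
    genMul 𝓡 π x (Finsupp.single m c) =
      Finsupp.single (m + Finsupp.single x 1) (monomialSign π x m • twist 𝓡 (π x) c) := by
  rw [genMul, AddMonoidHom.coe_toIntLinearMap, Finsupp.liftAddHom_apply_single]
  rfl

theorem genMul_anticomm (x y : ι) :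
    genMul 𝓡 π x * genMul 𝓡 π y =
      (-koszulSign (π x) (π y)) • (genMul 𝓡 π y * genMul 𝓡 π x) := by
  refine Finsupp.lhom_ext fun m c => ?_
  change genMul 𝓡 π x (genMul 𝓡 π y (Finsupp.single m c)) =
    (-koszulSign (π x) (π y)) • genMul 𝓡 π y (genMul 𝓡 π x (Finsupp.single m c))
  simp only [genMul_single, map_zsmul, Finsupp.smul_single, smul_smul]
  rw [monomialSign_anticomm, add_right_comm, twist_twist_comm]

variable (R ι) in
/-- Left multiplication by scalars on the free module on monomials. -/
noncomputable def scalarMul : R →+* Module.End ℤ ((ι →₀ ℕ) →₀ R) :=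
  Module.toModuleEnd ℤ ((ι →₀ ℕ) →₀ R)

theorem genMul_scalarMul (x : ι) (a : R) :
    genMul 𝓡 π x * scalarMul R ι a = scalarMul R ι (twist 𝓡 (π x) a) * genMul 𝓡 π x := by
  refine Finsupp.lhom_ext fun m c => ?_
  change genMul 𝓡 π x (a • Finsupp.single m c) =
    twist 𝓡 (π x) a • genMul 𝓡 π x (Finsupp.single m c)
  simp only [genMul_single, Finsupp.smul_single, smul_eq_mul, twist_mul, mul_smul_comm]

/-- Left multiplication by the vector with coordinates `r`. -/
noncomputable def vectorMul (r : ι → R) : Module.End ℤ ((ι →₀ ℕ) →₀ R) :=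
  ∑ x, scalarMul R ι (r x) * genMul 𝓡 π x

theorem vectorMul_single_one [DecidableEq ι] (x : ι) :
    vectorMul 𝓡 π (fun y => if x = y then (1 : R) else 0) = genMul 𝓡 π x := by
  rw [vectorMul, Finset.sum_eq_single x]
  · simp
  · intro y _ hy
    simp [hy.symm]
  · simp

variable {𝓡} [SuperCommutative 𝓡] {π}

theorem vectorMul_scalarMul {i j : ZMod 2} {a : R} (ha : a ∈ 𝓡 i) {r : ι → R}
    (hr : ∀ x, r x ∈ 𝓡 (j + π x)) :
    vectorMul 𝓡 π r * scalarMul R ι a =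
      koszulSign i j • (scalarMul R ι a * vectorMul 𝓡 π r) := by
  simp only [vectorMul, Finset.sum_mul, Finset.mul_sum, Finset.smul_sum]
  refine Finset.sum_congr rfl fun x _ => ?_
  rw [mul_assoc, genMul_scalarMul, ← mul_assoc, ← mul_assoc, ← map_mul, ← map_mul,
    twist_of_mem 𝓡 ha, mul_smul_comm, supercommute 𝓡 (hr x) ha, smul_smul, map_zsmul,
    smul_mul_assoc]
  congr 1
  exact (by decide : ∀ i j k : ZMod 2,
    koszulSign k i * koszulSign (j + k) i = koszulSign i j) i j (π x)

/-- The defining relation of `Λ(V)` holds in the model; with `vectorMul_scalarMul` this is what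
makes `Λ(V)` act on it. It suffices to compare the terms for each pair of generators, where only a
sign identity remains. -/
theorem vectorMul_anticomm {i j : ZMod 2} {r t : ι → R} (hr : ∀ x, r x ∈ 𝓡 (i + π x))
    (ht : ∀ x, t x ∈ 𝓡 (j + π x)) :
    vectorMul 𝓡 π r * vectorMul 𝓡 π t +
      koszulSign i j • (vectorMul 𝓡 π t * vectorMul 𝓡 π r) = 0 := by
  have key : ∀ x y, scalarMul R ι (r x) * genMul 𝓡 π x * (scalarMul R ι (t y) * genMul 𝓡 π y) +
      koszulSign i j • (scalarMul R ι (t y) * genMul 𝓡 π y *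
        (scalarMul R ι (r x) * genMul 𝓡 π x)) = 0 := by
    intro x y
    have h1 : ∀ (a b : R) (x y : ι), scalarMul R ι a * genMul 𝓡 π x *
        (scalarMul R ι b * genMul 𝓡 π y) =
        scalarMul R ι (a * twist 𝓡 (π x) b) * (genMul 𝓡 π x * genMul 𝓡 π y) := by
      intro a b x y
      rw [mul_assoc, ← mul_assoc (genMul 𝓡 π x), genMul_scalarMul, map_mul]
      simp only [mul_assoc]
    rw [h1, h1, twist_of_mem 𝓡 (hr x), twist_of_mem 𝓡 (ht y), genMul_anticomm 𝓡 π x y,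
      mul_smul_comm, mul_smul_comm, supercommute 𝓡 (hr x) (ht y)]
    simp only [map_zsmul, smul_mul_assoc, mul_smul_comm, smul_smul]
    rw [← add_smul]
    convert zero_smul ℤ _
    exact (by decide : ∀ i j k l : ZMod 2, -koszulSign k l *
      (koszulSign k (j + l) * koszulSign (i + k) (j + l)) +
        koszulSign i j * koszulSign l (i + k) = 0) i j (π x) (π y)
  simp only [vectorMul, Finset.sum_mul, Finset.mul_sum, Finset.smul_sum]
  rw [Finset.sum_comm (f := fun y x => koszulSign i j • (scalarMul R ι (t x) * genMul 𝓡 π x *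
        (scalarMul R ι (r y) * genMul 𝓡 π y)))]
  simp only [← Finset.sum_add_distrib, key, Finset.sum_const_zero]

variable (𝓡 π) in
/-- The elements of parity `j` of the free module on monomials. -/
def modelParity (j : ZMod 2) : AddSubgroup ((ι →₀ ℕ) →₀ R) where
  carrier := {f | ∀ m, f m ∈ 𝓡 (j + monomialParity π m)}
  zero_mem' _ := zero_mem _
  add_mem' hf hg m := add_mem (hf m) (hg m)
  neg_mem' hf m := neg_mem (hf m)

omit [SuperCommutative 𝓡] [LinearOrder ι] [GradedRing 𝓡] in
theorem single_mem_modelParity {j : ZMod 2} {n : ι →₀ ℕ} {c : R}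
    (hc : c ∈ 𝓡 (j + monomialParity π n)) : Finsupp.single n c ∈ modelParity 𝓡 π j := by
  classical
  intro m
  rw [Finsupp.single_apply]
  split_ifs with h
  · exact h ▸ hc
  · exact zero_mem _

omit [SuperCommutative 𝓡] in
theorem vectorMul_mem_modelParity {i j : ZMod 2} {r : ι → R} (hr : ∀ x, r x ∈ 𝓡 (i + π x))
    {f : (ι →₀ ℕ) →₀ R} (hf : f ∈ modelParity 𝓡 π j) :
    vectorMul 𝓡 π r f ∈ modelParity 𝓡 π (i + j) := by
  rw [← f.sum_single, Finsupp.sum, map_sum]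
  refine AddSubgroup.sum_mem _ fun n _ => ?_
  rw [vectorMul, LinearMap.sum_apply]
  refine AddSubgroup.sum_mem _ fun x _ => ?_
  change r x • genMul 𝓡 π x (Finsupp.single n (f n)) ∈ _
  rw [genMul_single, Finsupp.smul_single]
  refine single_mem_modelParity ?_
  rw [monomialParity_add_single, smul_eq_mul]
  have h := SetLike.GradedMul.mul_mem (hr x)
    (zsmul_mem (twist_mem 𝓡 (i := π x) (hf n)) (monomialSign π x n))
  convert h using 2
  ring

omit [SuperCommutative 𝓡] [LinearOrder ι] in
theorem scalarMul_mem_modelParity {i j : ZMod 2} {a : R} (ha : a ∈ 𝓡 i)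
    {f : (ι →₀ ℕ) →₀ R} (hf : f ∈ modelParity 𝓡 π j) :
    scalarMul R ι a f ∈ modelParity 𝓡 π (i + j) := by
  intro m
  have h := SetLike.GradedMul.mul_mem ha (hf m)
  rw [← add_assoc] at h
  exact h

end Model

/-! ### Sorted words and admissible monomials -/

section Words

variable {R ι : Type*} [Ring R] (𝓡 : ZMod 2 → AddSubgroup R) [GradedRing 𝓡] [Fintype ι]
  [LinearOrder ι] (π : ι → ZMod 2)

/-- The sorted word of a monomial. -/
noncomputable def monomialWord (m : ι →₀ ℕ) : List ι := (Finsupp.toMultiset m).sort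

/-- The monomials of degree `k` that do not vanish in the exterior algebra. -/
noncomputable def admissible (k : ℕ) : Finset (ι →₀ ℕ) :=
  (Finset.univ.finsuppAntidiag k).filter fun m => ∀ x, π x = 0 → m x ≤ 1

omit [Fintype ι] in
theorem coe_monomialWord (m : ι →₀ ℕ) : (monomialWord m : Multiset ι) = Finsupp.toMultiset m :=
  Multiset.sort_eq _ _

theorem sum_monomialWord_map {M : Type*} [AddCommMonoid M] (m : ι →₀ ℕ) (f : ι → M) :
    ((monomialWord m).map f).sum = ∑ x, m x • f x := by
  rw [← Multiset.sum_coe, ← Multiset.map_coe, coe_monomialWord,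
    Finset.sum_multiset_map_count]
  simp only [Finsupp.count_toMultiset, Finsupp.toFinset_toMultiset]
  refine Finset.sum_subset (Finset.subset_univ _) fun x _ hx => ?_
  rw [Finsupp.notMem_support_iff.1 hx, zero_smul]

theorem length_monomialWord {k : ℕ} {m : ι →₀ ℕ} (hm : m ∈ admissible π k) :
    (monomialWord m).length = k := by
  rw [monomialWord, Multiset.length_sort, Finsupp.card_toMultiset]
  rw [admissible, Finset.mem_filter, Finset.mem_finsuppAntidiag] at hm
  rw [← hm.1.1]
  exact Finsupp.sum_fintype _ _ fun _ => rfl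

/-- In a sorted word each generator multiplies a monomial with no smaller generator, so it passes
nothing and no sign arises. -/
theorem genMul_word (l : List ι) (hl : l.Pairwise (· ≤ ·))
    (hl' : ∀ x, π x = 0 → l.count x ≤ 1) :
    (l.map (genMul 𝓡 π)).prod (Finsupp.single 0 1) =
      Finsupp.single (Multiset.toFinsupp (l : Multiset ι)) 1 := by
  induction l with
  | nil => simp
  | cons x l ih =>
    rw [List.pairwise_cons] at hl
    rw [List.map_cons, List.prod_cons]
    change genMul 𝓡 π x ((l.map (genMul 𝓡 π)).prod (Finsupp.single 0 1)) = _
    rw [ih hl.2 fun y hy => (List.count_le_count_cons).trans (hl' y hy), genMul_single]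
    have h1 : twist 𝓡 (π x) 1 = 1 := by
      rw [twist_of_mem 𝓡 (SetLike.GradedOne.one_mem : (1 : R) ∈ 𝓡 0)]
      simp
    have h2 : monomialSign π x (Multiset.toFinsupp (l : Multiset ι)) = 1 := by
      rw [monomialSign, if_neg]
      · refine Finset.prod_eq_one fun y hy => ?_
        have hyl : y ∉ l := fun h => not_lt.2 (hl.1 y h) (Finset.mem_filter.1 hy).2
        simp [Multiset.toFinsupp_apply, List.count_eq_zero_of_not_mem hyl]
      · rintro ⟨h0, hx⟩
        have := hl' x h0
        rw [List.count_cons_self] at this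
        exact hx (by simpa using this)
    rw [h1, h2, one_smul]
    congr 1
    rw [← Multiset.cons_coe, ← Multiset.singleton_add, map_add, Multiset.toFinsupp_singleton,
      add_comm]

theorem genMul_monomialWord {k : ℕ} {m : ι →₀ ℕ} (hm : m ∈ admissible π k) :
    ((monomialWord m).map (genMul 𝓡 π)).prod (Finsupp.single 0 1) = Finsupp.single m 1 := by
  rw [genMul_word 𝓡 π (monomialWord m) (Multiset.pairwise_sort _ _), coe_monomialWord,
    Finsupp.toMultiset_toFinsupp]
  intro x hx
  rw [← Multiset.coe_count, coe_monomialWord, Finsupp.count_toMultiset]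
  exact (Finset.mem_filter.1 hm).2 x hx

end Words

/-! ### Commutation rules in the exterior algebra -/

section Relations

variable {R V : Type*} [Ring R] [AddCommGroup V] [Module R V]
  (𝓡 : ZMod 2 → AddSubgroup R) (𝓥 : ZMod 2 → AddSubgroup V)

theorem TensorAlg.ι_smul (a : R) (v : V) :
    TensorAlg.ι 𝓡 𝓥 (a • v) = TensorAlg.scalar 𝓡 𝓥 a * TensorAlg.ι 𝓡 𝓥 v :=
  (RingQuot.mkRingHom_rel (TensorRel.left_smul a v)).trans (map_mul _ _ _)

theorem TensorAlg.ι_mul_scalar {i j : ZMod 2} {a : R} {v : V} (ha : a ∈ 𝓡 i) (hv : v ∈ 𝓥 j) :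
    TensorAlg.ι 𝓡 𝓥 v * TensorAlg.scalar 𝓡 𝓥 a = TensorAlg.ι 𝓡 𝓥 (koszulSign i j • a • v) :=
  (map_mul _ _ _).symm.trans (RingQuot.mkRingHom_rel (TensorRel.right_smul ha hv))

namespace ExteriorAlg

/-- The canonical map `V → Λ(V)` as a linear map. -/
noncomputable def ιLin : V →ₗ[R] ExteriorAlg 𝓡 𝓥 where
  toFun := ι 𝓡 𝓥
  map_add' v w := by
    have h : TensorAlg.ι 𝓡 𝓥 (v + w) = TensorAlg.ι 𝓡 𝓥 v + TensorAlg.ι 𝓡 𝓥 w :=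
      (RingQuot.mkRingHom_rel (TensorRel.vector_add v w)).trans (map_add _ _ _)
    simp only [ι, h, map_add]
  map_smul' a v := by
    simp only [ι, TensorAlg.ι_smul, map_mul]
    rfl

theorem smul_eq_scalar_mul (a : R) (x : ExteriorAlg 𝓡 𝓥) : a • x = scalar 𝓡 𝓥 a * x := rfl

theorem smul_mul_eq (a : R) (x y : ExteriorAlg 𝓡 𝓥) : (a • x) * y = a • (x * y) := by
  simp only [smul_eq_scalar_mul, mul_assoc]

variable {𝓡 𝓥}

theorem ι_mul_scalar {i j : ZMod 2} {a : R} {v : V} (ha : a ∈ 𝓡 i) (hv : v ∈ 𝓥 j) :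
    ι 𝓡 𝓥 v * scalar 𝓡 𝓥 a = koszulSign i j • a • ι 𝓡 𝓥 v := by
  have h := congrArg (mk 𝓡 𝓥) (TensorAlg.ι_mul_scalar 𝓡 𝓥 ha hv)
  rw [map_mul] at h
  refine h.trans ?_
  change ιLin 𝓡 𝓥 (koszulSign i j • a • v) = koszulSign i j • a • ιLin 𝓡 𝓥 v
  rw [map_zsmul, map_smul]

theorem ι_mul_ι {i j : ZMod 2} {v u : V} (hv : v ∈ 𝓥 i) (hu : u ∈ 𝓥 j) :
    ι 𝓡 𝓥 v * ι 𝓡 𝓥 u = -(koszulSign i j • (ι 𝓡 𝓥 u * ι 𝓡 𝓥 v)) := by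
  have h := mk_rel (ExteriorRel.anticomm (𝓡 := 𝓡) hv hu)
  rw [map_add, map_zsmul, map_mul, map_mul, map_zero] at h
  exact eq_neg_of_add_eq_zero_left h

theorem ι_mul_smul [GradedRing 𝓡] {j : ZMod 2} {v : V} (hv : v ∈ 𝓥 j) (a : R)
    (y : ExteriorAlg 𝓡 𝓥) : ι 𝓡 𝓥 v * (a • y) = twist 𝓡 j a • (ι 𝓡 𝓥 v * y) := by
  have key : ∀ {i : ZMod 2} {c : R}, c ∈ 𝓡 i →
      ι 𝓡 𝓥 v * (c • y) = twist 𝓡 j c • (ι 𝓡 𝓥 v * y) := by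
    intro i c hc
    rw [smul_eq_scalar_mul, ← mul_assoc, ι_mul_scalar hc hv, smul_mul_assoc, smul_mul_eq,
      twist_of_mem 𝓡 hc, koszulSign_comm, smul_assoc]
  obtain ⟨a₀, ha₀, a₁, ha₁, rfl⟩ := exists_parity_decomposition 𝓡 0 a
  rw [add_smul, mul_add, map_add, add_smul, key ha₀, key ha₁]

/-- The relation only gives `2 v ∧ v = 0`; invertibility of `2` enters here. -/
theorem ι_mul_self_eq_zero (h2 : IsUnit (2 : R)) {v : V} (hv : v ∈ 𝓥 0) :
    ι 𝓡 𝓥 v * ι 𝓡 𝓥 v = 0 := by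
  have h := ι_mul_ι (𝓡 := 𝓡) hv hv
  rw [koszulSign_zero_left, one_smul, eq_neg_iff_add_eq_zero, ← two_mul] at h
  have h2' : IsUnit (2 : ExteriorAlg 𝓡 𝓥) := by
    have := h2.map (scalar 𝓡 𝓥)
    rwa [map_ofNat] at this
  exact (h2'.mul_right_eq_zero).1 h

end ExteriorAlg

end Relations

namespace ExteriorAlg

/-! ### Monomials span the exterior powers -/

section Spanning

variable {R V ι' : Type*} [Ring R] [AddCommGroup V] [Module R V]
  (𝓡 : ZMod 2 → AddSubgroup R) (𝓥 : ZMod 2 → AddSubgroup V)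

/-- The product of the vectors named by a word. -/
noncomputable def wordProd (b : ι' → V) (l : List ι') : ExteriorAlg 𝓡 𝓥 :=
  (l.map fun x => ι 𝓡 𝓥 (b x)).prod

theorem wordProd_eq_wedge (b : ι' → V) (l : List ι') :
    wordProd 𝓡 𝓥 b l = wedge 𝓡 𝓥 (fun i : Fin l.length => b (l.get i)) := by
  rw [wedge, wordProd]
  congr 1
  apply List.ext_get <;> simp

theorem wordProd_mem_power (b : ι' → V) {k : ℕ} {l : List ι'} (hl : l.length = k) :
    wordProd 𝓡 𝓥 b l ∈ power 𝓡 𝓥 k := by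
  subst hl
  rw [wordProd_eq_wedge]
  exact Submodule.subset_span ⟨_, rfl⟩

variable {𝓡 𝓥} {π : ι' → ZMod 2} {b : ι' → V}

theorem wordProd_perm (hb : ∀ x, b x ∈ 𝓥 (π x)) {l l' : List ι'} (h : l.Perm l') :
    wordProd 𝓡 𝓥 b l = wordProd 𝓡 𝓥 b l' ∨ wordProd 𝓡 𝓥 b l = -wordProd 𝓡 𝓥 b l' := by
  induction h with
  | nil => exact Or.inl rfl
  | cons x _ ih =>
    simp only [wordProd, List.map_cons, List.prod_cons] at ih ⊢
    rcases ih with h | h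
    · exact Or.inl (by rw [h])
    · exact Or.inr (by rw [h, mul_neg])
  | swap x y l =>
    simp only [wordProd, List.map_cons, List.prod_cons, ← mul_assoc]
    rw [ι_mul_ι (hb y) (hb x)]
    rcases (by decide : ∀ i j, koszulSign i j = 1 ∨ koszulSign i j = -1) (π y) (π x) with h | h
    · right
      rw [h, one_smul, neg_mul]
    · left
      rw [h, neg_smul, one_smul, neg_neg]
  | trans _ _ h₁ h₂ =>
    rcases h₁ with h₁ | h₁ <;> rcases h₂ with h₂ | h₂ <;> simp [h₁, h₂]

theorem wordProd_eq_zero [DecidableEq ι'] (h2 : IsUnit (2 : R)) (hb : ∀ x, b x ∈ 𝓥 (π x))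
    {l : List ι'} {x : ι'} (hx : π x = 0) (hl : 2 ≤ l.count x) : wordProd 𝓡 𝓥 b l = 0 := by
  have h1 : x ∈ l := List.count_pos_iff.1 (by omega)
  have h3 : x ∈ l.erase x := List.count_pos_iff.1 (by rw [List.count_erase_self]; omega)
  have hp : l.Perm (x :: x :: (l.erase x).erase x) :=
    (List.perm_cons_erase h1).trans ((List.perm_cons_erase h3).cons x)
  have h0 : wordProd 𝓡 𝓥 b (x :: x :: (l.erase x).erase x) = 0 := by
    have h := hb x
    rw [hx] at h
    simp only [wordProd, List.map_cons, List.prod_cons, ← mul_assoc]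
    rw [ι_mul_self_eq_zero h2 h, zero_mul]
  rcases wordProd_perm (𝓡 := 𝓡) hb hp with h | h <;> simp [h, h0]

variable [Fintype ι'] [LinearOrder ι']

variable (𝓡 𝓥 π b) in
/-- The span of the monomials of degree `k`. -/
noncomputable def monomialSpan (k : ℕ) : Submodule R (ExteriorAlg 𝓡 𝓥) :=
  Submodule.span R (Set.range fun m : admissible π k => wordProd 𝓡 𝓥 b (monomialWord m.1))

theorem wordProd_mem_monomialSpan (h2 : IsUnit (2 : R)) (hb : ∀ x, b x ∈ 𝓥 (π x))
    (l : List ι') : wordProd 𝓡 𝓥 b l ∈ monomialSpan 𝓡 𝓥 π b l.length := by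
  by_cases h : ∀ x, π x = 0 → l.count x ≤ 1
  · let m : ι' →₀ ℕ := Multiset.toFinsupp (l : Multiset ι')
    have hm : m ∈ admissible π l.length := by
      rw [admissible, Finset.mem_filter, Finset.mem_finsuppAntidiag]
      refine ⟨⟨?_, Finset.subset_univ _⟩, fun x hx => by simpa [m] using h x hx⟩
      have := Multiset.toFinsupp_sum_eq (l : Multiset ι')
      rw [Multiset.coe_card, Finsupp.sum_fintype _ _ fun _ => rfl] at this
      exact this
    have hp : l.Perm (monomialWord m) := by
      rw [← Multiset.coe_eq_coe, coe_monomialWord, Multiset.toFinsupp_toMultiset]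
    have hs : wordProd 𝓡 𝓥 b (monomialWord m) ∈ monomialSpan 𝓡 𝓥 π b l.length :=
      Submodule.subset_span ⟨⟨m, hm⟩, rfl⟩
    rcases wordProd_perm (𝓡 := 𝓡) hb hp with h | h <;> rw [h]
    · exact hs
    · exact neg_mem hs
  · push Not at h
    obtain ⟨x, hx, hl⟩ := h
    rw [wordProd_eq_zero h2 hb hx hl]
    exact zero_mem _

/-- Induction on the length. Expanding the first vector in the basis leaves products of a basis
vector with a combination of monomials; scalars pass to the left through `twist`, and the resulting
words are sorted up to sign or vanish. -/
theorem list_prod_mem_monomialSpan [GradedRing 𝓡] (h2 : IsUnit (2 : R))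
    (b : Module.Basis ι' R V) (hb : ∀ x, b x ∈ 𝓥 (π x)) (l : List V) :
    (l.map (ι 𝓡 𝓥)).prod ∈ monomialSpan 𝓡 𝓥 π b l.length := by
  induction l with
  | nil => exact wordProd_mem_monomialSpan h2 hb []
  | cons v l ih =>
    rw [List.map_cons, List.prod_cons, List.length_cons]
    generalize (l.map (ι 𝓡 𝓥)).prod = y at ih
    have hgen : ∀ x, ι 𝓡 𝓥 (b x) * y ∈ monomialSpan 𝓡 𝓥 π b (l.length + 1) := by
      intro x
      induction ih using Submodule.span_induction with
      | mem y hy =>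
        obtain ⟨m, rfl⟩ := hy
        have h := wordProd_mem_monomialSpan (𝓡 := 𝓡) h2 hb (x :: monomialWord m.1)
        rw [List.length_cons, length_monomialWord π m.2] at h
        exact h
      | zero => rw [mul_zero]; exact zero_mem _
      | add y z _ _ hy hz => rw [mul_add]; exact add_mem hy hz
      | smul a y _ hy => rw [ι_mul_smul (hb x)]; exact Submodule.smul_mem _ _ hy
    have hv : ι 𝓡 𝓥 v = ∑ x, b.repr v x • ι 𝓡 𝓥 (b x) := by
      change ιLin 𝓡 𝓥 v = ∑ x, b.repr v x • ιLin 𝓡 𝓥 (b x)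
      conv_lhs => rw [← b.sum_repr v]
      simp only [map_sum, map_smul]
    rw [hv, Finset.sum_mul]
    refine Submodule.sum_mem _ fun x _ => ?_
    rw [smul_mul_eq]
    exact Submodule.smul_mem _ _ (hgen x)

theorem monomialSpan_eq_power [GradedRing 𝓡] (h2 : IsUnit (2 : R))
    (b : Module.Basis ι' R V) (hb : ∀ x, b x ∈ 𝓥 (π x)) (k : ℕ) :
    monomialSpan 𝓡 𝓥 π b k = power 𝓡 𝓥 k := by
  refine le_antisymm (Submodule.span_le.2 ?_) (Submodule.span_le.2 ?_)
  · rintro _ ⟨m, rfl⟩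
    exact wordProd_mem_power 𝓡 𝓥 _ (length_monomialWord π m.2)
  · rintro _ ⟨v, rfl⟩
    have h := list_prod_mem_monomialSpan (𝓡 := 𝓡) h2 b hb (List.ofFn v)
    rw [List.map_ofFn, List.length_ofFn] at h
    exact h

end Spanning

/-! ### The action on the model, the monomial basis and the trace formula -/

section Representation

variable {R V ι' : Type*} [Ring R] [AddCommGroup V] [Module R V]
  {𝓡 : ZMod 2 → AddSubgroup R} [GradedRing 𝓡] [SuperCommutative 𝓡] {𝓥 : ZMod 2 → AddSubgroup V}
  [Fintype ι'] [LinearOrder ι'] {π : ι' → ZMod 2} {b : Module.Basis ι' R V}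

variable (𝓡 π b) in
/-- The action of the free ring on the free module on monomials. -/
noncomputable def freeRep : FreeAlgebra ℤ (R ⊕ V) →ₐ[ℤ] Module.End ℤ ((ι' →₀ ℕ) →₀ R) :=
  FreeAlgebra.lift ℤ (Sum.elim (scalarMul R ι') fun v => vectorMul 𝓡 π (b.repr v))

omit [SuperCommutative 𝓡] in
theorem freeRep_inl (a : R) :
    freeRep 𝓡 π b (FreeAlgebra.ι ℤ (Sum.inl a)) = scalarMul R ι' a := by
  simp [freeRep]

omit [SuperCommutative 𝓡] in
theorem freeRep_inr (v : V) :
    freeRep 𝓡 π b (FreeAlgebra.ι ℤ (Sum.inr v)) = vectorMul 𝓡 π (b.repr v) := by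
  simp [freeRep]

omit [SuperCommutative 𝓡] in
theorem vectorMul_add (r t : ι' → R) :
    vectorMul 𝓡 π (r + t) = vectorMul 𝓡 π r + vectorMul 𝓡 π t := by
  simp [vectorMul, add_mul, Finset.sum_add_distrib]

omit [SuperCommutative 𝓡] in
theorem vectorMul_smul (a : R) (r : ι' → R) :
    vectorMul 𝓡 π (a • r) = scalarMul R ι' a * vectorMul 𝓡 π r := by
  simp [vectorMul, Finset.mul_sum, mul_assoc]

theorem freeRep_rel (hb : IsHomogBasis 𝓡 𝓥 b π) {x y : FreeAlgebra ℤ (R ⊕ V)}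
    (h : TensorRel 𝓡 𝓥 x y) : freeRep 𝓡 π b x = freeRep 𝓡 π b y := by
  cases h with
  | scalar_one => simp [freeRep_inl]
  | scalar_add a c => simp [freeRep_inl]
  | scalar_mul a c => simp [freeRep_inl]
  | vector_add v w => simp [freeRep_inr, vectorMul_add]
  | left_smul a v => simp [freeRep_inl, freeRep_inr, vectorMul_smul]
  | @right_smul i j a v ha hv =>
    have h0 : ∀ (n : ℤ) (r : ι' → R), vectorMul 𝓡 π (n • r) = n • vectorMul 𝓡 π r := by
      intro n r
      simp [vectorMul, Finset.smul_sum, mul_assoc]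
    rw [map_mul, freeRep_inl, freeRep_inr, freeRep_inr,
      vectorMul_scalarMul ha ((hb _ _).1 hv), map_zsmul, map_smul, Finsupp.coe_smul,
      Finsupp.coe_smul, h0, vectorMul_smul]

/-- The action of `T(V)` on the free module on monomials. -/
noncomputable def tensorRep (hb : IsHomogBasis 𝓡 𝓥 b π) :
    TensorAlg 𝓡 𝓥 →+* Module.End ℤ ((ι' →₀ ℕ) →₀ R) :=
  RingQuot.lift ⟨(freeRep 𝓡 π b).toRingHom, fun _ _ h => freeRep_rel hb h⟩

theorem tensorRep_mk (hb : IsHomogBasis 𝓡 𝓥 b π) (x : FreeAlgebra ℤ (R ⊕ V)) :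
    tensorRep hb (TensorAlg.mk 𝓡 𝓥 x) = freeRep 𝓡 π b x :=
  RingQuot.lift_mkRingHom_apply _ _ _

/-- The action of `Λ(V)` on the free module on monomials. -/
noncomputable def rep (hb : IsHomogBasis 𝓡 𝓥 b π) :
    ExteriorAlg 𝓡 𝓥 →+* Module.End ℤ ((ι' →₀ ℕ) →₀ R) :=
  RingQuot.lift ⟨tensorRep hb, fun x y h => by
    cases h with
    | anticomm hv hu =>
      rw [map_add, map_zsmul, map_mul, map_mul, map_zero]
      simp only [TensorAlg.ι, tensorRep_mk, freeRep_inr]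
      exact vectorMul_anticomm ((hb _ _).1 hv) ((hb _ _).1 hu)⟩

theorem rep_mk (hb : IsHomogBasis 𝓡 𝓥 b π) (x : TensorAlg 𝓡 𝓥) :
    rep hb (mk 𝓡 𝓥 x) = tensorRep hb x :=
  RingQuot.lift_mkRingHom_apply _ _ _

theorem rep_ι (hb : IsHomogBasis 𝓡 𝓥 b π) (v : V) :
    rep hb (ι 𝓡 𝓥 v) = vectorMul 𝓡 π (b.repr v) := by
  rw [ι, rep_mk, TensorAlg.ι, tensorRep_mk, freeRep_inr]

theorem rep_scalar (hb : IsHomogBasis 𝓡 𝓥 b π) (a : R) :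
    rep hb (scalar 𝓡 𝓥 a) = scalarMul R ι' a := by
  change rep hb (mk 𝓡 𝓥 (TensorAlg.mk 𝓡 𝓥 _)) = _
  rw [rep_mk, tensorRep_mk, freeRep_inl]

/-- The coordinates of an element of `Λ(V)` with respect to the monomials. -/
noncomputable def coord (hb : IsHomogBasis 𝓡 𝓥 b π) :
    ExteriorAlg 𝓡 𝓥 →ₗ[R] ((ι' →₀ ℕ) →₀ R) where
  toFun x := rep hb x (Finsupp.single 0 1)
  map_add' x y := by rw [map_add, LinearMap.add_apply]
  map_smul' a x := by
    rw [smul_eq_scalar_mul, map_mul, rep_scalar]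
    rfl

theorem coord_list_prod (hb : IsHomogBasis 𝓡 𝓥 b π) (l : List V) :
    coord hb (l.map (ι 𝓡 𝓥)).prod =
      (l.map fun v => vectorMul 𝓡 π (b.repr v)).prod (Finsupp.single 0 1) := by
  change rep hb _ _ = _
  rw [map_list_prod, List.map_map]
  simp only [Function.comp_def, rep_ι]

theorem coord_wordProd (hb : IsHomogBasis 𝓡 𝓥 b π) (c : ι' → V) (l : List ι') :
    coord hb (wordProd 𝓡 𝓥 c l) =
      (l.map fun x => vectorMul 𝓡 π (b.repr (c x))).prod (Finsupp.single 0 1) := by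
  have h := coord_list_prod hb (l.map c)
  rw [List.map_map, List.map_map] at h
  exact h

theorem coord_monomial (hb : IsHomogBasis 𝓡 𝓥 b π) {k : ℕ} {m : ι' →₀ ℕ}
    (hm : m ∈ admissible π k) :
    coord hb (wordProd 𝓡 𝓥 b (monomialWord m)) = Finsupp.single m 1 := by
  rw [coord_wordProd, ← genMul_monomialWord 𝓡 π hm]
  congr 3
  funext x
  rw [← vectorMul_single_one, b.repr_self]
  congr 1
  funext y
  rw [Finsupp.single_apply]

/-- The basis of `Λᵏ V` consisting of monomials. -/
noncomputable def powerBasis (h2 : IsUnit (2 : R)) (hb : IsHomogBasis 𝓡 𝓥 b π) (k : ℕ) :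
    Module.Basis (admissible π k) R (power 𝓡 𝓥 k) :=
  Module.Basis.mk (v := fun m => ⟨wordProd 𝓡 𝓥 b (monomialWord m.1),
      wordProd_mem_power 𝓡 𝓥 _ (length_monomialWord π m.2)⟩)
    (by
      -- Acting on the empty monomial sends the monomials of `Λᵏ V` to distinct standard basis
      -- vectors of the model.
      refine LinearIndependent.of_comp ((coord hb).comp (power 𝓡 𝓥 k).subtype) ?_
      have h : ((coord hb).comp (power 𝓡 𝓥 k).subtype) ∘
          (fun m : admissible π k => (⟨wordProd 𝓡 𝓥 b (monomialWord m.1),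
            wordProd_mem_power 𝓡 𝓥 _ (length_monomialWord π m.2)⟩ : power 𝓡 𝓥 k)) =
          (fun n => Finsupp.single n (1 : R)) ∘ Subtype.val :=
        funext fun m => coord_monomial hb m.2
      rw [h]
      exact (Finsupp.basisSingleOne (R := R)).linearIndependent.comp _ Subtype.val_injective)
    (by
      rintro ⟨x, hx⟩ -
      have hx' := hx
      rw [← monomialSpan_eq_power h2 b hb.mem k, monomialSpan] at hx'
      have hmap := Submodule.map_span (power 𝓡 𝓥 k).subtype
        (Set.range fun m : admissible π k => (⟨wordProd 𝓡 𝓥 b (monomialWord m.1),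
          wordProd_mem_power 𝓡 𝓥 _ (length_monomialWord π m.2)⟩ : power 𝓡 𝓥 k))
      rw [← Set.range_comp] at hmap
      obtain ⟨y, hy, hyx⟩ := hmap.symm ▸ hx'
      have : y = ⟨x, hx⟩ := Subtype.ext hyx
      exact this ▸ hy)

theorem powerBasis_apply (h2 : IsUnit (2 : R)) (hb : IsHomogBasis 𝓡 𝓥 b π) (k : ℕ)
    (m : admissible π k) :
    (powerBasis h2 hb k m : ExteriorAlg 𝓡 𝓥) = wordProd 𝓡 𝓥 b (monomialWord m.1) := by
  rw [powerBasis, Module.Basis.mk_apply]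

theorem powerBasis_repr (h2 : IsUnit (2 : R)) (hb : IsHomogBasis 𝓡 𝓥 b π) (k : ℕ)
    (x : power 𝓡 𝓥 k) (m : admissible π k) :
    (powerBasis h2 hb k).repr x m = coord hb (x : ExteriorAlg 𝓡 𝓥) m.1 := by
  conv_rhs => rw [← (powerBasis h2 hb k).sum_repr x]
  simp only [Submodule.coe_sum, Submodule.coe_smul, powerBasis_apply, map_sum, map_smul,
    coord_monomial hb (Subtype.prop _), Finsupp.finsetSum_apply, Finsupp.smul_apply]
  rw [Finset.sum_eq_single m]
  · simp
  · intro n _ hn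
    simp [hn]
  · simp

/-- The parity pieces of `Λ(V)` are defined by generators, so it is not evident that they meet only
in zero. In the model parity is read off coefficient by coefficient, and the disjointness becomes
visible. -/
theorem coord_mem_modelParity (hb : IsHomogBasis 𝓡 𝓥 b π) {j : ZMod 2} {x : ExteriorAlg 𝓡 𝓥}
    (hx : x ∈ parity 𝓡 𝓥 j) : coord hb x ∈ modelParity 𝓡 π j := by
  refine (AddSubgroup.closure_le ((modelParity 𝓡 π j).comap (coord hb).toAddMonoidHom)).2 ?_ hx
  rintro _ ⟨k, i, a, d, v, ha, hv, hj, rfl⟩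
  change coord hb (a • wedge 𝓡 𝓥 v) ∈ modelParity 𝓡 π j
  rw [map_smul, ← hj]
  refine scalarMul_mem_modelParity ha ?_
  clear hj hx
  induction k with
  | zero =>
    change rep hb (wedge 𝓡 𝓥 v) (Finsupp.single 0 1) ∈ _
    rw [wedge, List.ofFn_zero, List.prod_nil, map_one]
    refine single_mem_modelParity ?_
    simp only [monomialParity, Finset.univ_eq_empty, Finset.sum_empty, Finsupp.coe_zero,
      Pi.zero_apply, zero_smul, Finset.sum_const_zero, add_zero]
    exact SetLike.GradedOne.one_mem
  | succ k ih =>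
    rw [Fin.sum_univ_succ]
    change rep hb (wedge 𝓡 𝓥 v) (Finsupp.single 0 1) ∈ _
    rw [wedge, List.ofFn_succ, List.prod_cons, map_mul, rep_ι]
    exact vectorMul_mem_modelParity ((hb _ _).1 (hv 0)) (ih _ _ fun l => hv l.succ)

omit [SuperCommutative 𝓡] [Fintype ι'] [LinearOrder ι'] in
theorem wordProd_mem_parity {c : ι' → V} (hc : ∀ x, c x ∈ 𝓥 (π x))
    (l : List ι') :
    wordProd 𝓡 𝓥 c l ∈ parity 𝓡 𝓥 (l.map π).sum := by
  refine AddSubgroup.subset_closure ⟨l.length, 0, 1, fun i => π (l.get i), fun i => c (l.get i),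
    SetLike.GradedOne.one_mem, fun i => hc _, ?_, ?_⟩
  · rw [zero_add, ← List.sum_ofFn]
    congr 1
    apply List.ext_get <;> simp
  · rw [one_smul, wordProd_eq_wedge]

theorem isHomogBasis_powerBasis (h2 : IsUnit (2 : R)) (hb : IsHomogBasis 𝓡 𝓥 b π) (k : ℕ) :
    IsHomogBasis 𝓡 (powerParity 𝓡 𝓥 k) (powerBasis h2 hb k)
      (fun m => monomialParity π m.1) := by
  have hmem : ∀ (j : ZMod 2) (x : power 𝓡 𝓥 k), x ∈ powerParity 𝓡 𝓥 k j →
      ∀ m, (powerBasis h2 hb k).repr x m ∈ 𝓡 (j + monomialParity π m.1) := by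
    intro j x hx m
    rw [powerBasis_repr]
    exact coord_mem_modelParity hb hx m.1
  refine isHomogBasis_of_mem _ _ ?_ ?_ ?_
  · intro m
    change ((powerBasis h2 hb k m : power 𝓡 𝓥 k) : ExteriorAlg 𝓡 𝓥) ∈ parity 𝓡 𝓥 _
    rw [powerBasis_apply, monomialParity, ← sum_monomialWord_map]
    exact wordProd_mem_parity hb.mem _
  · intro i j a x ha hx
    change a • (x : ExteriorAlg 𝓡 𝓥) ∈ parity 𝓡 𝓥 (i + j)
    refine (AddSubgroup.closure_le ((parity 𝓡 𝓥 (i + j)).comap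
      (DistribSMul.toAddMonoidHom (ExteriorAlg 𝓡 𝓥) a))).2 ?_ hx
    rintro _ ⟨k, i', a', d, v, ha', hv, hj, rfl⟩
    refine AddSubgroup.subset_closure ⟨k, i + i', a * a', d, v, SetLike.GradedMul.mul_mem ha ha',
      hv, by rw [add_assoc, hj], ?_⟩
    exact smul_smul _ _ _
  · intro j x hx hx'
    refine (powerBasis h2 hb k).repr.map_eq_zero_iff.1 (Finsupp.ext fun m => ?_)
    exact eq_zero_of_mem_of_mem 𝓡 (i := j + monomialParity π m.1)
      (j := j + 1 + monomialParity π m.1) (by simp) (hmem _ _ hx m) (hmem _ _ hx' m)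

omit [GradedRing 𝓡] [SuperCommutative 𝓡] in
theorem powerMap_mem (A : EvenOperator R 𝓥) (k : ℕ) (j : ZMod 2) (x : power 𝓡 𝓥 k)
    (hx : x ∈ powerParity 𝓡 𝓥 k j) : powerMap 𝓡 A k x ∈ powerParity 𝓡 𝓥 k j := by
  change mapLin 𝓡 A (x : ExteriorAlg 𝓡 𝓥) ∈ parity 𝓡 𝓥 j
  refine (AddSubgroup.closure_le ((parity 𝓡 𝓥 j).comap (mapLin 𝓡 A).toAddMonoidHom)).2 ?_ hx
  rintro _ ⟨k, i, a, d, v, ha, hv, hj, rfl⟩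
  refine AddSubgroup.subset_closure ⟨k, i, a, d, fun l => A.toLin (v l), ha,
    fun l => A.map_mem (hv l), hj, ?_⟩
  change mapLin 𝓡 A (a • wedge 𝓡 𝓥 v) = _
  rw [map_smul]
  exact congrArg (a • ·) (map_wedge 𝓡 A v)

/-- The trace of `Λᵏ A` as an expression in the matrix `a` of `A`. -/
noncomputable def matrixExteriorTrace (𝓡 : ZMod 2 → AddSubgroup R) [GradedRing 𝓡]
    (π : ι' → ZMod 2) (a : ι' → ι' → R) (k : ℕ) : R :=
  ∑ m ∈ admissible π k, koszulSign (monomialParity π m) (monomialParity π m) •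
    ((monomialWord m).map fun x => vectorMul 𝓡 π (a x)).prod (Finsupp.single 0 1) m

/-- Once the trace depends only on the matrix of `A`, the module `V` can be forgotten and the
scalars changed. -/
theorem supertrace_powerMap (h2 : IsUnit (2 : R)) (hb : IsHomogBasis 𝓡 𝓥 b π)
    (A : EvenOperator R 𝓥) (k : ℕ) :
    supertrace (powerParity 𝓡 𝓥 k) (powerMap 𝓡 A k) =
      matrixExteriorTrace 𝓡 π (fun x => b.repr (A.toLin (b x))) k := by
  rw [(isHomogBasis_powerBasis h2 hb k).supertrace_eq _ (powerMap_mem A k), basisSupertrace,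
    matrixExteriorTrace, ← Finset.sum_coe_sort (admissible π k)]
  refine Finset.sum_congr rfl fun m _ => ?_
  rw [powerBasis_repr, ← coord_wordProd hb fun x => A.toLin (b x)]
  have h : ((powerMap 𝓡 A k (powerBasis h2 hb k m) : power 𝓡 𝓥 k) : ExteriorAlg 𝓡 𝓥) =
      wordProd 𝓡 𝓥 (fun x => A.toLin (b x)) (monomialWord m.1) := by
    change map 𝓡 A (powerBasis h2 hb k m : ExteriorAlg 𝓡 𝓥) = _
    rw [powerBasis_apply, wordProd, wordProd, map_list_prod, List.map_map]
    simp only [Function.comp_def, map_ι]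
  rw [h]

theorem supertrace_powerMap_mem (h2 : IsUnit (2 : R)) (hb : IsHomogBasis 𝓡 𝓥 b π)
    (A : EvenOperator R 𝓥) (k : ℕ) :
    supertrace (powerParity 𝓡 𝓥 k) (powerMap 𝓡 A k) ∈ 𝓡 0 := by
  rw [(isHomogBasis_powerBasis h2 hb k).supertrace_eq _ (powerMap_mem A k)]
  exact (isHomogBasis_powerBasis h2 hb k).basisSupertrace_mem _ (powerMap_mem A k)

end Representation

end ExteriorAlg

/-! ### Hankel determinants of rational series -/

section Hankel

variable {E : Type*} [CommRing E]

/-- The coefficients of `D`, in reversed order, form a kernel vector of the Hankel matrix whose last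
entry is `1`. Over any commutative ring such a vector forces the determinant to vanish. -/
theorem hankel_det_eq_zero {p q : ℕ} (D C : PowerSeries E)
    (hD0 : PowerSeries.coeff 0 D = 1) (hD : ∀ n, q < n → PowerSeries.coeff n D = 0)
    (hDC : ∀ n, p < n → PowerSeries.coeff n (D * C) = 0) (c : ℤ → E)
    (hneg : ∀ k < 0, c k = 0) (hc : ∀ n : ℕ, c n = PowerSeries.coeff n C)
    {k : ℤ} (hk : (p : ℤ) - q < k) :
    (Matrix.of fun i j : Fin (q + 1) => c (k + (i : ℕ) + (j : ℕ))).det = 0 := by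
  set H : Matrix (Fin (q + 1)) (Fin (q + 1)) E :=
    Matrix.of fun i j : Fin (q + 1) => c (k + (i : ℕ) + (j : ℕ)) with hH
  have hrec : ∀ n : ℕ, p < n →
      ∑ l ∈ Finset.range (q + 1), c (n - l) * PowerSeries.coeff l D = 0 := by
    intro n hn
    rw [← hDC n hn, PowerSeries.coeff_mul,
      Finset.Nat.sum_antidiagonal_eq_sum_range_succ
        (fun a b => PowerSeries.coeff a D * PowerSeries.coeff b C)]
    -- Both sums are extended to a common range: one because `D` has no coefficient beyond `q`, the
    -- other because `c` vanishes at negative indices.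
    have h1 : ∑ l ∈ Finset.range (q + 1), c (n - l) * PowerSeries.coeff l D =
        ∑ l ∈ Finset.range (n + q + 1), c (n - l) * PowerSeries.coeff l D := by
      refine Finset.sum_subset (Finset.range_subset_range.2 (by omega)) fun l _ hl => ?_
      rw [hD l (by simpa using hl), mul_zero]
    have h2 : ∑ l ∈ Finset.range (n + 1), c (n - l) * PowerSeries.coeff l D =
        ∑ l ∈ Finset.range (n + q + 1), c (n - l) * PowerSeries.coeff l D := by
      refine Finset.sum_subset (Finset.range_subset_range.2 (by omega)) fun l _ hl => ?_
      rw [hneg _ (by simp at hl; omega), zero_mul]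
    rw [h1, ← h2]
    refine Finset.sum_congr rfl fun l hl => ?_
    have hl' : l ≤ n := by simpa [Nat.lt_succ_iff] using hl
    rw [← Nat.cast_sub hl', hc, mul_comm]
  have hv : H.mulVec (fun j => PowerSeries.coeff (q - j) D) = 0 := by
    funext i
    -- Row `i` is the recurrence at `n = k + q + i`, which exceeds `p` exactly because `k > p - q`;
    -- in particular `n` is natural even if `k` is negative.
    obtain ⟨n, hn⟩ : ∃ n : ℕ, (n : ℤ) = k + q + (i : ℕ) := ⟨(k + q + (i : ℕ)).toNat, by omega⟩
    rw [Pi.zero_apply, ← hrec n (by omega), ← Finset.sum_range_reflect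
      (fun l : ℕ => c (n - l) * PowerSeries.coeff l D), Finset.sum_range]
    change ∑ j, H i j * PowerSeries.coeff (q - j) D = _
    refine Finset.sum_congr rfl fun j _ => ?_
    have hj : (j : ℕ) ≤ q := Nat.lt_succ_iff.1 j.2
    have e1 : q + 1 - 1 - (j : ℕ) = q - j := by omega
    rw [e1, hH, Matrix.of_apply]
    congr 2
    push_cast [hj]
    omega
  -- Multiplying by the adjugate gives `det H` times the vector; its last coordinate is `det H`
  -- itself.
  have h := congrArg (fun u => H.adjugate.mulVec u (Fin.last q)) hv
  simpa [Matrix.mulVec_mulVec, Matrix.adjugate_mul, Matrix.smul_mulVec, hD0] using h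

end Hankel

namespace ExteriorAlg

/-! ### Naturality of the trace in the ring of scalars -/

section Naturality

variable {R S ι' : Type*} [Ring R] [Ring S] (𝓡 : ZMod 2 → AddSubgroup R) [GradedRing 𝓡]
  (𝓢 : ZMod 2 → AddSubgroup S) [GradedRing 𝓢] [Fintype ι'] [LinearOrder ι']
  (π : ι' → ZMod 2) (φ : R →+* S) (hφ : ∀ i, ∀ a ∈ 𝓡 i, φ a ∈ 𝓢 i)

include hφ in
theorem mapRange_vectorMul (r : ι' → R) (f : (ι' →₀ ℕ) →₀ R) :
    Finsupp.mapRange.addMonoidHom φ.toAddMonoidHom (vectorMul 𝓡 π r f) =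
      vectorMul 𝓢 π (fun x => φ (r x)) (Finsupp.mapRange.addMonoidHom φ.toAddMonoidHom f) := by
  induction f using Finsupp.induction_linear with
  | zero => simp
  | add f g hf hg => simp only [map_add, hf, hg]
  | single m c =>
    simp only [vectorMul, LinearMap.sum_apply, map_sum]
    refine Finset.sum_congr rfl fun x _ => ?_
    change Finsupp.mapRange.addMonoidHom φ.toAddMonoidHom
        (r x • genMul 𝓡 π x (Finsupp.single m c)) =
      φ (r x) • genMul 𝓢 π x (Finsupp.mapRange.addMonoidHom φ.toAddMonoidHom
        (Finsupp.single m c))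
    rw [genMul_single, Finsupp.smul_single, Finsupp.mapRange.addMonoidHom_apply,
      Finsupp.mapRange_single, Finsupp.mapRange.addMonoidHom_apply, Finsupp.mapRange_single,
      genMul_single, Finsupp.smul_single]
    congr 1
    change φ (r x * _) = φ (r x) * (_ • twist 𝓢 (π x) (φ c))
    rw [map_mul, map_zsmul, map_twist 𝓡 𝓢 φ hφ]

include hφ in
theorem map_matrixExteriorTrace (a : ι' → ι' → R) (k : ℕ) :
    φ (matrixExteriorTrace 𝓡 π a k) = matrixExteriorTrace 𝓢 π (fun x y => φ (a x y)) k := by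
  have key : ∀ l : List ι', Finsupp.mapRange.addMonoidHom φ.toAddMonoidHom
      ((l.map fun x => vectorMul 𝓡 π (a x)).prod (Finsupp.single 0 1)) =
      (l.map fun x => vectorMul 𝓢 π fun y => φ (a x y)).prod (Finsupp.single 0 1) := by
    intro l
    induction l with
    | nil => simp
    | cons x l ih =>
      rw [List.map_cons, List.prod_cons, List.map_cons, List.prod_cons, Module.End.mul_apply,
        Module.End.mul_apply, mapRange_vectorMul 𝓡 𝓢 π φ hφ, ih]
  simp only [matrixExteriorTrace, map_sum, map_zsmul]
  refine Finset.sum_congr rfl fun m _ => ?_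
  rw [← key]
  rfl

end Naturality

/-! ### The diagonal case -/

section Diagonal

variable {R V ι' : Type*} [Ring R] [AddCommGroup V] [Module R V]
  {𝓡 : ZMod 2 → AddSubgroup R} [GradedRing 𝓡] [SuperCommutative 𝓡] {𝓥 : ZMod 2 → AddSubgroup V}
  [Fintype ι'] [LinearOrder ι'] {π : ι' → ZMod 2} {b : Module.Basis ι' R V}

omit [SuperCommutative 𝓡] in
theorem coe_evenPart_mem (a : evenPart 𝓡) : (a : R) ∈ 𝓡 0 := a.2

omit [Fintype ι'] [LinearOrder ι'] in
theorem wordProd_smul (hb : ∀ x, b x ∈ 𝓥 (π x)) (θ : ι' → evenPart 𝓡) (l : List ι') :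
    wordProd 𝓡 𝓥 (fun x => (θ x : R) • b x) l =
      ((l.map θ).prod : R) • wordProd 𝓡 𝓥 b l := by
  induction l with
  | nil => simp [wordProd]
  | cons x l ih =>
    have h : wordProd 𝓡 𝓥 (fun x => (θ x : R) • b x) (x :: l) =
        ι 𝓡 𝓥 ((θ x : R) • b x) * wordProd 𝓡 𝓥 (fun x => (θ x : R) • b x) l := by
      simp [wordProd]
    have h' : wordProd 𝓡 𝓥 b (x :: l) = ι 𝓡 𝓥 (b x) * wordProd 𝓡 𝓥 b l := by
      simp [wordProd]
    have h'' : ι 𝓡 𝓥 ((θ x : R) • b x) = (θ x : R) • ι 𝓡 𝓥 (b x) :=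
      (ιLin 𝓡 𝓥).map_smul _ _
    rw [h, ih, h', h'', smul_mul_eq, ι_mul_smul (hb x),
      twist_of_mem 𝓡 (coe_evenPart_mem (l.map θ).prod), koszulSign_zero_right, one_smul, smul_smul,
      List.map_cons, List.prod_cons]
    rfl

theorem prod_monomialWord_map {M : Type*} [CommMonoid M] (m : ι' →₀ ℕ) (f : ι' → M) :
    ((monomialWord m).map f).prod = ∏ x, f x ^ m x :=
  sum_monomialWord_map (M := Additive M) m f

omit [LinearOrder ι'] in
theorem koszulSign_monomialParity (m : ι' →₀ ℕ) :
    koszulSign (monomialParity π m) (monomialParity π m) =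
      ∏ x, koszulSign (π x) (π x) ^ m x := by
  have hadd : ∀ i j : ZMod 2, koszulSign (i + j) (i + j) = koszulSign i i * koszulSign j j := by
    decide
  let χ : Multiplicative (ZMod 2) →* ℤ :=
    { toFun := fun i => koszulSign i.toAdd i.toAdd
      map_one' := by decide
      map_mul' := fun i j => hadd _ _ }
  have h := map_prod χ (fun x => Multiplicative.ofAdd (π x) ^ m x) Finset.univ
  simp only [map_pow] at h
  exact h

/-- The contribution of an eigenvector of parity `i` to the generating function. -/
noncomputable def eigenSeries {E : Type*} [CommRing E] (i : ZMod 2) (t : E) : PowerSeries E :=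
  if i = 0 then 1 + PowerSeries.C t * PowerSeries.X else PowerSeries.mk fun n => (-t) ^ n

theorem one_add_mul_geometric {E : Type*} [CommRing E] (t : E) :
    (1 + PowerSeries.C t * PowerSeries.X) * PowerSeries.mk (fun n => (-t) ^ n) = 1 := by
  ext n
  rw [add_mul, one_mul, map_add, mul_assoc, PowerSeries.coeff_C_mul]
  cases n with
  | zero => simp
  | succ n =>
    rw [PowerSeries.coeff_succ_X_mul, PowerSeries.coeff_mk, PowerSeries.coeff_mk,
      PowerSeries.coeff_one, if_neg n.succ_ne_zero]
    ring

/-- The monomial `m` is an eigenvector of `Λᵏ A` with eigenvalue `∏ θ x ^ m x`. Its supertrace sign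
is multiplicative in the generators, so the sum over monomials factors into one series per
generator. -/
theorem supertrace_powerMap_eigenbasis (h2 : IsUnit (2 : R)) (hb : IsHomogBasis 𝓡 𝓥 b π)
    (A : EvenOperator R 𝓥) (θ : ι' → evenPart 𝓡)
    (hA : ∀ x, A.toLin (b x) = (θ x : R) • b x) (k : ℕ) :
    supertrace (powerParity 𝓡 𝓥 k) (powerMap 𝓡 A k) =
      (PowerSeries.coeff k (∏ x, eigenSeries (π x) (θ x)) : evenPart 𝓡) := by
  rw [supertrace_powerMap h2 hb, matrixExteriorTrace, PowerSeries.coeff_prod]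
  -- A repeated even generator contributes nothing, since `1 + tX` has no coefficient beyond degree
  -- one.
  have hvanish : ∀ m ∈ Finset.univ.finsuppAntidiag k, m ∉ admissible π k →
      ∏ x, PowerSeries.coeff (m x) (eigenSeries (π x) (θ x)) = 0 := by
    intro m hm hm'
    simp only [admissible, Finset.mem_filter, hm, true_and, not_forall, not_le] at hm'
    obtain ⟨x, hx, hmx⟩ := hm'
    refine Finset.prod_eq_zero (Finset.mem_univ x) ?_
    rw [eigenSeries, if_pos hx, map_add, PowerSeries.coeff_one, if_neg (by omega),
      PowerSeries.coeff_C_mul, PowerSeries.coeff_X, if_neg (by omega)]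
    simp
  rw [← Finset.sum_subset (Finset.filter_subset _ _) hvanish]
  change _ = (evenPart 𝓡).subtype _
  rw [map_sum]
  refine Finset.sum_congr rfl fun m hm => ?_
  have hterm : ∏ x, PowerSeries.coeff (m x) (eigenSeries (π x) (θ x)) =
      koszulSign (monomialParity π m) (monomialParity π m) • ∏ x, θ x ^ m x := by
    rw [koszulSign_monomialParity, zsmul_eq_mul, Int.cast_prod, ← Finset.prod_mul_distrib]
    refine Finset.prod_congr rfl fun x _ => ?_
    by_cases hx : π x = 0
    · have h1 := (Finset.mem_filter.1 hm).2 x hx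
      rw [eigenSeries, if_pos hx, hx, koszulSign_zero_left]
      interval_cases m x <;> simp [PowerSeries.coeff_one]
    · have h1 : π x = 1 := (by decide : ∀ a : ZMod 2, a ≠ 0 → a = 1) _ hx
      have h11 : koszulSign 1 1 = -1 := by decide
      rw [eigenSeries, if_neg hx, h1, h11, PowerSeries.coeff_mk]
      push_cast
      rw [← mul_pow, neg_one_mul]
  rw [hterm, map_zsmul, ← prod_monomialWord_map]
  congr 1
  have hcoord := coord_wordProd hb (fun x => A.toLin (b x)) (monomialWord m)
  rw [← hcoord]
  simp only [hA]
  rw [wordProd_smul hb.mem, map_smul, coord_monomial hb hm]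
  simp

variable (b) in
theorem hankel_det_eq_zero_of_eigenbasis (h2 : IsUnit (2 : R)) (hb : IsHomogBasis 𝓡 𝓥 b π)
    (A : EvenOperator R 𝓥) (θ : ι' → evenPart 𝓡)
    (hA : ∀ x, A.toLin (b x) = (θ x : R) • b x) (c : ℤ → evenPart 𝓡)
    (hneg : ∀ k < 0, c k = 0)
    (hc : ∀ n : ℕ, (c n : R) = supertrace (powerParity 𝓡 𝓥 n) (powerMap 𝓡 A n))
    {p q : ℕ} (hp : (Finset.univ.filter fun x => π x = 0).card = p)
    (hq : (Finset.univ.filter fun x => π x ≠ 0).card = q) {k : ℤ} (hk : (p : ℤ) - q < k) :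
    (Matrix.of fun i j : Fin (q + 1) => c (k + (i : ℕ) + (j : ℕ))).det = 0 := by
  let f : ι' → Polynomial (evenPart 𝓡) := fun x => 1 + Polynomial.C (θ x) * Polynomial.X
  have hf : ∀ s : Finset ι', (∏ x ∈ s, f x).natDegree ≤ s.card := by
    intro s
    refine (Polynomial.natDegree_prod_le _ _).trans ?_
    rw [Finset.card_eq_sum_ones]
    refine Finset.sum_le_sum fun x _ => ?_
    change (1 + Polynomial.C (θ x) * Polynomial.X).natDegree ≤ 1
    compute_degree
  have hcoe : ∀ x, (f x : PowerSeries (evenPart 𝓡)) = 1 + PowerSeries.C (θ x) * PowerSeries.X := by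
    intro x
    simp [f]
  have hcoe_prod : ∀ s : Finset ι', ((∏ x ∈ s, f x : Polynomial (evenPart 𝓡)) :
      PowerSeries (evenPart 𝓡)) = ∏ x ∈ s, (1 + PowerSeries.C (θ x) * PowerSeries.X) := by
    intro s
    rw [← Polynomial.coeToPowerSeries.ringHom_apply, map_prod]
    exact Finset.prod_congr rfl fun x _ => hcoe x
  -- The denominator is the product of the factors `1 + θ x X` over odd `x`. It cancels the
  -- geometric series and leaves the product over even `x`, of degree at most `p`.
  refine hankel_det_eq_zero (p := p)
    ((∏ x with π x ≠ 0, f x : Polynomial (evenPart 𝓡)) : PowerSeries (evenPart 𝓡))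
    (∏ x, eigenSeries (π x) (θ x)) ?_ ?_ ?_ c hneg ?_ hk
  · rw [hcoe_prod, PowerSeries.coeff_zero_eq_constantCoeff_apply, map_prod]
    exact Finset.prod_eq_one fun x _ => by simp
  · intro n hn
    rw [Polynomial.coeff_coe]
    exact Polynomial.coeff_eq_zero_of_natDegree_lt (((hf _).trans hq.le).trans_lt hn)
  · intro n hn
    have hprod : ((∏ x with π x ≠ 0, f x : Polynomial (evenPart 𝓡)) : PowerSeries (evenPart 𝓡)) *
        ∏ x, eigenSeries (π x) (θ x) =
        ((∏ x with π x = 0, f x : Polynomial (evenPart 𝓡)) : PowerSeries (evenPart 𝓡)) := by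
      rw [hcoe_prod, hcoe_prod, ← Finset.prod_filter_mul_prod_filter_not Finset.univ
        (fun x => π x = 0), mul_left_comm, ← Finset.prod_mul_distrib,
        Finset.prod_eq_one (s := Finset.univ.filter fun x => ¬ π x = 0), mul_one]
      · refine Finset.prod_congr rfl fun x hx => ?_
        rw [eigenSeries, if_pos (Finset.mem_filter.1 hx).2]
      · intro x hx
        rw [eigenSeries, if_neg (Finset.mem_filter.1 hx).2]
        exact one_add_mul_geometric _
    rw [hprod, Polynomial.coeff_coe]
    exact Polynomial.coeff_eq_zero_of_natDegree_lt (((hf _).trans hp.le).trans_lt hn)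
  · intro n
    exact Subtype.ext ((hc n).trans (supertrace_powerMap_eigenbasis h2 hb A θ hA n))

end Diagonal

end ExteriorAlg

/-! ### Polynomials and Laurent series over a supercommutative ring -/

section GradedConstructions

/-- A ring whose even and odd parts are complementary and multiply correctly is graded. -/
noncomputable abbrev gradedRingOfParts {S : Type*} [Ring S] (𝓢 : ZMod 2 → AddSubgroup S)
    (hone : (1 : S) ∈ 𝓢 0)
    (hmul : ∀ (i j : ZMod 2) (a b : S), a ∈ 𝓢 i → b ∈ 𝓢 j → a * b ∈ 𝓢 (i + j))
    (hdec : ∀ a, ∃ b ∈ 𝓢 0, ∃ c ∈ 𝓢 1, a = b + c)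
    (hdisj : ∀ a, a ∈ 𝓢 0 → a ∈ 𝓢 1 → a = 0) : GradedRing 𝓢 :=
  { one_mem := hone
    mul_mem := fun {i j a b} ha hb => hmul i j a b ha hb
    toDecomposition := DirectSum.IsInternal.chooseDecomposition 𝓢 <| by
      have hsum : ∀ x : DirectSum (ZMod 2) fun i => 𝓢 i,
          DirectSum.coeAddMonoidHom 𝓢 x = x 0 + x 1 := by
        intro x
        induction x using DirectSum.induction_on with
        | zero => simp
        | of i x =>
          rw [DirectSum.coeAddMonoidHom_of]
          obtain rfl | rfl := parity_eq_zero_or_one i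
          · rw [DirectSum.of_eq_same, DirectSum.of_eq_of_ne _ _ _ (by decide)]
            simp
          · rw [DirectSum.of_eq_same, DirectSum.of_eq_of_ne _ _ _ (by decide)]
            simp
        | add x y hx hy =>
          rw [map_add, hx, hy, DirectSum.add_apply, DirectSum.add_apply, AddSubgroup.coe_add,
            AddSubgroup.coe_add]
          abel
      refine ⟨(injective_iff_map_eq_zero _).2 fun x hx => ?_, fun a => ?_⟩
      · rw [hsum] at hx
        have h0 : (x 0 : S) = 0 := by
          refine hdisj _ (x 0).2 ?_
          rw [eq_neg_of_add_eq_zero_left hx]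
          exact neg_mem (x 1).2
        have h1 : (x 1 : S) = 0 := by rwa [h0, zero_add] at hx
        refine DFinsupp.ext fun i => Subtype.ext ?_
        obtain rfl | rfl := parity_eq_zero_or_one i
        · exact h0
        · exact h1
      · obtain ⟨b, hb, c, hc, rfl⟩ := hdec a
        refine ⟨DirectSum.of (fun i => 𝓢 i) 0 ⟨b, hb⟩ + DirectSum.of (fun i => 𝓢 i) 1 ⟨c, hc⟩, ?_⟩
        rw [map_add, DirectSum.coeAddMonoidHom_of, DirectSum.coeAddMonoidHom_of] }

variable {R : Type*} [Ring R] (𝓡 : ZMod 2 → AddSubgroup R)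

/-- The parity grading of `R[X]`, in which `X` is even. -/
def polyParity (i : ZMod 2) : AddSubgroup (Polynomial R) where
  carrier := {f | ∀ n, f.coeff n ∈ 𝓡 i}
  zero_mem' n := by rw [Polynomial.coeff_zero]; exact zero_mem _
  add_mem' hf hg n := by rw [Polynomial.coeff_add]; exact add_mem (hf n) (hg n)
  neg_mem' hf n := by rw [Polynomial.coeff_neg]; exact neg_mem (hf n)

theorem monomial_mem_polyParity {i : ZMod 2} {a : R} (ha : a ∈ 𝓡 i) (n : ℕ) :
    Polynomial.monomial n a ∈ polyParity 𝓡 i := by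
  intro m
  rw [Polynomial.coeff_monomial]
  split_ifs
  · exact ha
  · exact zero_mem _

noncomputable instance [GradedRing 𝓡] : GradedRing (polyParity 𝓡) :=
  gradedRingOfParts (polyParity 𝓡)
    (monomial_mem_polyParity 𝓡 SetLike.GradedOne.one_mem 0)
    (fun i j f g hf hg n => by
      rw [Polynomial.coeff_mul]
      exact AddSubgroup.sum_mem _ fun x _ => SetLike.GradedMul.mul_mem (hf _) (hg _))
    (fun f => by
      induction f using Polynomial.induction_on' with
      | add f g hf hg =>
        obtain ⟨a, ha, b, hb, rfl⟩ := hf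
        obtain ⟨c, hc, d, hd, rfl⟩ := hg
        exact ⟨_, add_mem ha hc, _, add_mem hb hd, by abel⟩
      | monomial n a =>
        obtain ⟨b, hb, c, hc, rfl⟩ := exists_parity_decomposition 𝓡 0 a
        exact ⟨_, monomial_mem_polyParity 𝓡 hb n, _, monomial_mem_polyParity 𝓡 hc n, map_add _ _ _⟩)
    (fun f h0 h1 => Polynomial.ext fun n =>
      eq_zero_of_mem_of_mem 𝓡 (i := 0) (j := 1) (by decide) (h0 n) (h1 n))

instance [SuperCommutative 𝓡] : SuperCommutative (polyParity 𝓡) where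
  mul_comm' {i j f g} hf hg := by
    ext n
    rw [Polynomial.coeff_smul, Polynomial.coeff_mul, Polynomial.coeff_mul, Finset.smul_sum,
      ← Finset.Nat.sum_antidiagonal_swap]
    exact Finset.sum_congr rfl fun x _ => supercommute 𝓡 (hf _) (hg _)

/-- The parity grading of the ring of Laurent series, in which the variable is even. -/
def laurentParity (i : ZMod 2) : AddSubgroup (HahnSeries ℤ R) where
  carrier := {f | ∀ n, f.coeff n ∈ 𝓡 i}
  zero_mem' n := by rw [HahnSeries.coeff_zero]; exact zero_mem _
  add_mem' hf hg n := by rw [HahnSeries.coeff_add]; exact add_mem (hf n) (hg n)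
  neg_mem' hf n := by rw [HahnSeries.coeff_neg]; exact neg_mem (hf n)

theorem single_mem_laurentParity {i : ZMod 2} {a : R} (ha : a ∈ 𝓡 i) (n : ℤ) :
    HahnSeries.single n a ∈ laurentParity 𝓡 i := by
  intro m
  rw [HahnSeries.coeff_single]
  split_ifs
  · exact ha
  · exact zero_mem _

noncomputable instance [GradedRing 𝓡] : GradedRing (laurentParity 𝓡) :=
  gradedRingOfParts (laurentParity 𝓡)
    (single_mem_laurentParity 𝓡 SetLike.GradedOne.one_mem 0)
    (fun i j f g hf hg n => by
      rw [HahnSeries.coeff_mul]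
      exact AddSubgroup.sum_mem _ fun x _ => SetLike.GradedMul.mul_mem (hf _) (hg _))
    (fun f => by
      let e : ZMod 2 → R →+ R := fun i =>
        (𝓡 i).subtype.comp ((DFinsupp.evalAddMonoidHom i).comp
          (DirectSum.decomposeAddEquiv 𝓡).toAddMonoidHom)
      have he : ∀ a, a = e 0 a + e 1 a := by
        intro a
        exact eq_even_add_odd 𝓡 a
      refine ⟨f.map (e 0), fun n => ?_, f.map (e 1), fun n => ?_, ?_⟩
      · exact (DirectSum.decompose 𝓡 (f.coeff n) 0).2
      · exact (DirectSum.decompose 𝓡 (f.coeff n) 1).2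
      · ext n
        exact he _)
    (fun f h0 h1 => HahnSeries.ext <| funext fun n =>
      eq_zero_of_mem_of_mem 𝓡 (i := 0) (j := 1) (by decide) (h0 n) (h1 n))

instance [SuperCommutative 𝓡] : SuperCommutative (laurentParity 𝓡) where
  mul_comm' {i j f g} hf hg := by
    ext n
    rw [HahnSeries.coeff_smul, HahnSeries.coeff_mul, HahnSeries.coeff_mul, Finset.smul_sum]
    refine Finset.sum_nbij' Prod.swap Prod.swap ?_ ?_ (fun _ _ => rfl) (fun _ _ => rfl)
      fun x _ => supercommute 𝓡 (hf _) (hg _)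
    · intro x hx
      simp only [Finset.mem_antidiagonal, Prod.fst_swap, Prod.snd_swap] at hx ⊢
      exact ⟨hx.2.1, hx.1, by rw [add_comm]; exact hx.2.2⟩
    · intro x hx
      simp only [Finset.mem_antidiagonal, Prod.fst_swap, Prod.snd_swap] at hx ⊢
      exact ⟨hx.2.1, hx.1, by rw [add_comm]; exact hx.2.2⟩

variable (R) in
/-- The embedding of `R[X]` into Laurent series sending `X` to the inverse of the variable. -/
noncomputable def polyToLaurent : Polynomial R →+* HahnSeries ℤ R :=
  Polynomial.eval₂RingHom' HahnSeries.C (HahnSeries.single (-1) 1) fun a => by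
    change HahnSeries.single 0 a * HahnSeries.single (-1) 1 =
      HahnSeries.single (-1) 1 * HahnSeries.single 0 a
    simp [HahnSeries.single_mul_single]

theorem polyToLaurent_monomial (n : ℕ) (a : R) :
    polyToLaurent R (Polynomial.monomial n a) = HahnSeries.single (-n : ℤ) a := by
  change Polynomial.eval₂ _ _ _ = _
  rw [Polynomial.eval₂_monomial, HahnSeries.single_pow]
  change HahnSeries.single 0 a * _ = _
  simp [HahnSeries.single_mul_single]

theorem coeff_polyToLaurent (f : Polynomial R) (n : ℕ) :
    (polyToLaurent R f).coeff (-n : ℤ) = f.coeff n := by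
  induction f using Polynomial.induction_on' with
  | add f g hf hg => rw [map_add, HahnSeries.coeff_add, hf, hg, Polynomial.coeff_add]
  | monomial m a =>
    rw [polyToLaurent_monomial, HahnSeries.coeff_single, Polynomial.coeff_monomial]
    by_cases h : m = n <;> simp [h, Ne.symm, eq_comm (a := n)]

theorem polyToLaurent_injective : Function.Injective (polyToLaurent R) := by
  intro f g h
  ext n
  rw [← coeff_polyToLaurent, h, coeff_polyToLaurent]

theorem polyToLaurent_mem {i : ZMod 2} {f : Polynomial R} (hf : f ∈ polyParity 𝓡 i) :
    polyToLaurent R f ∈ laurentParity 𝓡 i := by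
  rw [f.as_sum_support, map_sum]
  refine AddSubgroup.sum_mem _ fun n _ => ?_
  rw [polyToLaurent_monomial]
  exact single_mem_laurentParity 𝓡 (hf n) _

end GradedConstructions

/-! ### Matrices as even operators on coordinate vectors -/

section Coordinates

variable {R ι : Type*} [Ring R] (𝓡 : ZMod 2 → AddSubgroup R) [Fintype ι] (π : ι → ZMod 2)

/-- The parity grading of the module of coordinate vectors. -/
def piParity (j : ZMod 2) : AddSubgroup (ι → R) where
  carrier := {v | ∀ x, v x ∈ 𝓡 (j + π x)}
  zero_mem' _ := zero_mem _
  add_mem' hf hg x := add_mem (hf x) (hg x)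
  neg_mem' hf x := neg_mem (hf x)

theorem isHomogBasis_basisFun : IsHomogBasis 𝓡 (piParity 𝓡 π) (Pi.basisFun R ι) π := by
  intro j v
  simp only [Pi.basisFun_repr]
  rfl

variable {𝓡 π} in
/-- The even operator with a given matrix. -/
noncomputable def matrixOperator [GradedRing 𝓡] (a : Matrix ι ι R)
    (ha : ∀ x y, a x y ∈ 𝓡 (π x + π y)) : EvenOperator R (piParity 𝓡 π) where
  toLin := a.vecMulLinear
  map_mem {i v} hv y := by
    refine AddSubgroup.sum_mem _ fun x _ => ?_
    have h := SetLike.GradedMul.mul_mem (hv x) (ha x y)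
    rwa [add_assoc, ← add_assoc (π x), parity_add_self, zero_add] at h

variable [LinearOrder ι] [GradedRing 𝓡] [SuperCommutative 𝓡]

theorem supertrace_matrixOperator (h2 : IsUnit (2 : R)) (a : Matrix ι ι R)
    (ha : ∀ x y, a x y ∈ 𝓡 (π x + π y)) (k : ℕ) :
    supertrace (ExteriorAlg.powerParity 𝓡 (piParity 𝓡 π) k)
      (ExteriorAlg.powerMap 𝓡 (matrixOperator a ha) k) =
        ExteriorAlg.matrixExteriorTrace 𝓡 π a k := by
  rw [ExteriorAlg.supertrace_powerMap h2 (isHomogBasis_basisFun 𝓡 π)]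
  congr 1
  funext x y
  rw [Pi.basisFun_repr, Pi.basisFun_apply]
  exact congrFun (Matrix.single_one_vecMul x a) y

/-- Evenness is seen by realising the matrix as an even operator, whose supertrace has even terms.
-/
theorem matrixExteriorTrace_mem (h2 : IsUnit (2 : R)) (a : Matrix ι ι R)
    (ha : ∀ x y, a x y ∈ 𝓡 (π x + π y)) (k : ℕ) :
    ExteriorAlg.matrixExteriorTrace 𝓡 π a k ∈ 𝓡 0 := by
  rw [← supertrace_matrixOperator 𝓡 π h2 a ha]
  exact ExteriorAlg.supertrace_powerMap_mem h2 (isHomogBasis_basisFun 𝓡 π) _ k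

end Coordinates

/-! ### Fixed points in the `X`-adic topology -/

section Contraction

variable {R : Type*} [Ring R]

/-- Congruence of power series modulo `X ^ m`. -/
def SeriesCongr (m : ℕ) (f g : PowerSeries R) : Prop :=
  ∀ n < m, PowerSeries.coeff n f = PowerSeries.coeff n g

theorem SeriesCongr.sub {m : ℕ} {f f' g g' : PowerSeries R} (hf : SeriesCongr m f f')
    (hg : SeriesCongr m g g') : SeriesCongr m (f - g) (f' - g') := by
  intro n hn
  rw [map_sub, map_sub, hf n hn, hg n hn]

theorem SeriesCongr.mul {m : ℕ} {f f' g g' : PowerSeries R} (hf : SeriesCongr m f f')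
    (hg : SeriesCongr m g g') : SeriesCongr m (f * g) (f' * g') := by
  intro n hn
  rw [PowerSeries.coeff_mul, PowerSeries.coeff_mul]
  refine Finset.sum_congr rfl fun x hx => ?_
  have := Finset.HasAntidiagonal.mem_antidiagonal.1 hx
  rw [hf x.1 (by omega), hg x.2 (by omega)]

theorem SeriesCongr.sum {κ : Type*} {s : Finset κ} {m : ℕ} {f g : κ → PowerSeries R}
    (h : ∀ x, SeriesCongr m (f x) (g x)) : SeriesCongr m (∑ x ∈ s, f x) (∑ x ∈ s, g x) := by
  intro n hn
  rw [map_sum, map_sum]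
  exact Finset.sum_congr rfl fun x _ => h x n hn

theorem SeriesCongr.mul_left_succ {m : ℕ} {t f g : PowerSeries R}
    (ht : PowerSeries.coeff 0 t = 0) (h : SeriesCongr m f g) :
    SeriesCongr (m + 1) (t * f) (t * g) := by
  intro n hn
  rw [PowerSeries.coeff_mul, PowerSeries.coeff_mul]
  refine Finset.sum_congr rfl fun x hx => ?_
  have := Finset.HasAntidiagonal.mem_antidiagonal.1 hx
  rcases Nat.eq_zero_or_pos x.1 with h0 | h0
  · rw [h0, ht, zero_mul, zero_mul]
  · rw [h x.2 (by omega)]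

/-- The iterates from `0` stabilise coefficient by coefficient, and the limit is fixed. The
subgroups `H x` carry parity constraints along: they hold for every iterate, hence for the limit. -/
theorem exists_fixed_point_of_contraction {κ : Type*} (F : (κ → PowerSeries R) → κ → PowerSeries R)
    (hF : ∀ m f g, (∀ x, SeriesCongr m (f x) (g x)) → ∀ x, SeriesCongr (m + 1) (F f x) (F g x))
    (H : κ → AddSubgroup R)
    (hH : ∀ f, (∀ x n, PowerSeries.coeff n (f x) ∈ H x) →
      ∀ x n, PowerSeries.coeff n (F f x) ∈ H x) :
    ∃ f, F f = f ∧ ∀ x n, PowerSeries.coeff n (f x) ∈ H x := by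
  have hmem : ∀ m x n, PowerSeries.coeff n (F^[m] 0 x) ∈ H x := by
    intro m
    induction m with
    | zero =>
      intro x n
      rw [Function.iterate_zero, id, Pi.zero_apply, map_zero]
      exact zero_mem _
    | succ m ih =>
      rw [Function.iterate_succ_apply']
      exact hH _ ih
  have hstep : ∀ m d x, SeriesCongr m (F^[m] 0 x) (F^[m + d] 0 x) := by
    intro m
    induction m with
    | zero => exact fun d x n hn => absurd hn n.not_lt_zero
    | succ m ih =>
      intro d
      rw [Nat.succ_add, Function.iterate_succ_apply', Function.iterate_succ_apply']
      exact hF m _ _ (ih d)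
  let f : κ → PowerSeries R := fun x => PowerSeries.mk fun n =>
    PowerSeries.coeff n (F^[n + 1] 0 x)
  have hf : ∀ m x, SeriesCongr m (f x) (F^[m] 0 x) := by
    intro m x n hn
    obtain ⟨d, rfl⟩ := Nat.exists_eq_add_of_le (Nat.succ_le_of_lt hn)
    rw [PowerSeries.coeff_mk]
    exact hstep (n + 1) d x n n.lt_succ_self
  refine ⟨f, funext fun x => PowerSeries.ext fun n => ?_, fun x n => ?_⟩
  · rw [hF n f _ (hf n) x n n.lt_succ_self, ← Function.iterate_succ_apply' F n 0,
      hf (n + 1) x n n.lt_succ_self]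
  · rw [PowerSeries.coeff_mk]
    exact hmem _ _ _

theorem exists_right_inverse_of_coeff_zero {κ : Type*} [Fintype κ] [DecidableEq κ]
    (P : Matrix κ κ (PowerSeries R))
    (hP : ∀ x y, PowerSeries.coeff 0 (P x y) = (1 : Matrix κ κ R) x y) :
    ∃ Q : Matrix κ κ (PowerSeries R), P * Q = 1 ∧
      ∀ x y, PowerSeries.coeff 0 (Q x y) = (1 : Matrix κ κ R) x y := by
  have hone : ∀ x y, PowerSeries.coeff 0 ((1 : Matrix κ κ (PowerSeries R)) x y) =
      (1 : Matrix κ κ R) x y := by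
    intro x y
    rw [Matrix.one_apply, Matrix.one_apply]
    split_ifs <;> simp
  have hN : ∀ x y, PowerSeries.coeff 0 ((P - 1) x y) = 0 := by
    intro x y
    rw [Matrix.sub_apply, map_sub, hP, hone, sub_self]
  -- The equation `P * Q = 1` is read as `Q = 1 - (P - 1) * Q`, a contraction because `P - 1` has no
  -- constant term.
  obtain ⟨f, hf, -⟩ := exists_fixed_point_of_contraction (κ := κ × κ)
    (fun f z => (1 : Matrix κ κ (PowerSeries R)) z.1 z.2 -
      ∑ y, (P - 1) z.1 y * f (y, z.2))
    (fun m f g h z => SeriesCongr.sub (fun _ _ => rfl) (SeriesCongr.sum fun y =>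
      SeriesCongr.mul_left_succ (hN _ _) (h _))) (fun _ => ⊤) (fun _ _ _ _ => trivial)
  let Q : Matrix κ κ (PowerSeries R) := Matrix.of fun x y => f (x, y)
  have hQ : Q = 1 - (P - 1) * Q := by
    ext1 x y
    exact (congrFun hf (x, y)).symm
  refine ⟨Q, ?_, fun x y => ?_⟩
  · rw [sub_mul, one_mul] at hQ
    have h := sub_eq_iff_eq_add.1 (sub_sub_cancel 1 (P * Q - Q))
    rw [← hQ] at h
    rw [sub_add_cancel] at h
    exact h.symm
  · have h : Q x y = (1 : Matrix κ κ (PowerSeries R)) x y - ∑ z, (P - 1) x z * Q z y :=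
      congrFun (congrFun hQ x) y
    rw [h, map_sub, hone, map_sum, Finset.sum_eq_zero, sub_zero]
    intro z _
    rw [PowerSeries.coeff_mul, Finset.Nat.antidiagonal_zero, Finset.sum_singleton, hN, zero_mul]

theorem isUnit_of_coeff_zero {κ : Type*} [Fintype κ] [DecidableEq κ]
    (P : Matrix κ κ (PowerSeries R))
    (hP : ∀ x y, PowerSeries.coeff 0 (P x y) = (1 : Matrix κ κ R) x y) :
    ∃ Q : Matrix κ κ (PowerSeries R), P * Q = 1 ∧ Q * P = 1 := by
  obtain ⟨Q, hPQ, hQ⟩ := exists_right_inverse_of_coeff_zero P hP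
  -- The right inverse `Q` has identity constant term too, so it has its own right inverse, which
  -- must be `P`.
  obtain ⟨Z, hQZ, -⟩ := exists_right_inverse_of_coeff_zero Q hQ
  have h : P = Z := left_inv_eq_right_inv hPQ hQZ
  exact ⟨Q, hPQ, h ▸ hQZ⟩

end Contraction

/-! ### Eigenvectors of a perturbed diagonal matrix -/

section Eigenvectors

/-- Here `g` stands for `1 / (X⁻ᵏ - X⁻ⁱ)`, the inverse of a difference of two poles. It exists over
the integers because the lowest coefficient of `X ^ i - X ^ k` is a unit, so nothing has to be
inverted in `R`. -/
theorem exists_inverse_difference {i k : ℕ} (hi : 0 < i) (hk : 0 < k) (h : i ≠ k) :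
    ∃ g : PowerSeries ℤ, PowerSeries.coeff 0 g = 0 ∧
      g * (PowerSeries.X ^ i - PowerSeries.X ^ k) = PowerSeries.X ^ (i + k) := by
  have key : ∀ {i k : ℕ}, 0 < k → i < k → ∃ g : PowerSeries ℤ, PowerSeries.coeff 0 g = 0 ∧
      g * (PowerSeries.X ^ i - PowerSeries.X ^ k) = PowerSeries.X ^ (i + k) := by
    intro i k hk h
    obtain ⟨d, rfl⟩ := Nat.exists_eq_add_of_lt h
    have hu : IsUnit (1 - PowerSeries.X ^ (d + 1) : PowerSeries ℤ) := by
      rw [PowerSeries.isUnit_iff_constantCoeff]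
      simp
    obtain ⟨w, hw⟩ := hu.exists_left_inv
    refine ⟨PowerSeries.X ^ (i + d + 1) * w, ?_, ?_⟩
    · simp [PowerSeries.coeff_zero_eq_constantCoeff]
    · linear_combination (PowerSeries.X ^ (i + d + 1) * PowerSeries.X ^ i) * hw
  rcases lt_or_gt_of_ne h with h | h
  · exact key hk h
  · obtain ⟨g, hg0, hg⟩ := key hi h
    refine ⟨-g, by rw [map_neg, hg0, neg_zero], ?_⟩
    rw [add_comm i k, ← hg]
    ring

variable {R ι : Type*} [Ring R] {𝓡 : ZMod 2 → AddSubgroup R} [GradedRing 𝓡] [Fintype ι]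
  {π : ι → ZMod 2}

theorem coeff_mul_mem {i j : ZMod 2} {f g : PowerSeries R}
    (hf : ∀ n, PowerSeries.coeff n f ∈ 𝓡 i) (hg : ∀ n, PowerSeries.coeff n g ∈ 𝓡 j) (n : ℕ) :
    PowerSeries.coeff n (f * g) ∈ 𝓡 (i + j) := by
  rw [PowerSeries.coeff_mul]
  exact AddSubgroup.sum_mem _ fun x _ => SetLike.GradedMul.mul_mem (hf _) (hg _)

theorem coeff_map_intCast_mem (g : PowerSeries ℤ) (n : ℕ) :
    PowerSeries.coeff n (PowerSeries.map (Int.castRingHom R) g) ∈ 𝓡 0 := by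
  rw [PowerSeries.coeff_map, eq_intCast, ← zsmul_one]
  exact zsmul_mem SetLike.GradedOne.one_mem _

variable [DecidableEq ι]

/-- The equations for an eigenvector, with coordinate `1` at `i`, of a perturbation of a diagonal
matrix with inverse eigenvalue differences `g`. -/
theorem exists_perturbed_eigenvector (a : ι → ι → R) (ha : ∀ x y, a x y ∈ 𝓡 (π x + π y)) (i : ι)
    (g : ι → PowerSeries ℤ) (hg : ∀ k, PowerSeries.coeff 0 (g k) = 0) :
    ∃ P : ι → PowerSeries R, P i = 1 ∧
      (∀ k n, PowerSeries.coeff n (P k) ∈ 𝓡 (π i + π k)) ∧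
      ∀ k, k ≠ i → P k = PowerSeries.map (Int.castRingHom R) (g k) *
        (P k * (∑ j, P j * PowerSeries.C (a j i)) - ∑ j, P j * PowerSeries.C (a j k)) := by
  have hC : ∀ x y n, PowerSeries.coeff n (PowerSeries.C (a x y)) ∈ 𝓡 (π x + π y) := by
    intro x y n
    rw [PowerSeries.coeff_C]
    split_ifs
    · exact ha x y
    · exact zero_mem _
  have hone : ∀ n, PowerSeries.coeff n (1 : PowerSeries R) ∈ 𝓡 0 := by
    intro n
    rw [PowerSeries.coeff_one]
    split_ifs
    · exact SetLike.GradedOne.one_mem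
    · exact zero_mem _
  -- The vanishing constant term of `g k` makes the map contracting. It preserves the parity `π i +
  -- π k` of the coordinates because the entries of `a` are homogeneous.
  obtain ⟨P, hP, hmem⟩ := exists_fixed_point_of_contraction (κ := ι)
    (fun P k => if k = i then 1 else PowerSeries.map (Int.castRingHom R) (g k) *
        (P k * (∑ j, P j * PowerSeries.C (a j i)) - ∑ j, P j * PowerSeries.C (a j k)))
    (fun m f f' h k => by
      split_ifs
      · exact fun _ _ => rfl
      · have hsum : ∀ l, SeriesCongr m (∑ j, f j * PowerSeries.C (a j l))
            (∑ j, f' j * PowerSeries.C (a j l)) :=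
          fun l => SeriesCongr.sum fun j => (h j).mul fun _ _ => rfl
        refine SeriesCongr.mul_left_succ ?_ (((h k).mul (hsum i)).sub (hsum k))
        rw [PowerSeries.coeff_map, hg, map_zero])
    (fun k => 𝓡 (π i + π k))
    (fun f hf k n => by
      split_ifs with hk
      · rw [hk, parity_add_self]
        exact hone n
      · have hsum : ∀ l n, PowerSeries.coeff n (∑ j, f j * PowerSeries.C (a j l)) ∈
            𝓡 (π i + π l) := by
          intro l n
          rw [map_sum]
          refine AddSubgroup.sum_mem _ fun j _ => ?_
          have h := coeff_mul_mem (hf j) (hC j l) n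
          rwa [← add_assoc, parity_add_cancel] at h
        have hsub : ∀ n, PowerSeries.coeff n (f k * (∑ j, f j * PowerSeries.C (a j i)) -
            ∑ j, f j * PowerSeries.C (a j k)) ∈ 𝓡 (π i + π k) := by
          intro n
          rw [map_sub]
          refine sub_mem ?_ (hsum k n)
          have h := coeff_mul_mem (hf k) (hsum i) n
          rwa [parity_add_self, add_zero] at h
        have h := coeff_mul_mem (coeff_map_intCast_mem (𝓡 := 𝓡) (g k)) hsub n
        rwa [zero_add] at h)
  refine ⟨P, ?_, hmem, fun k hk => ?_⟩
  · have h := congrFun hP i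
    rw [if_pos rfl] at h
    exact h.symm
  · have h := congrFun hP k
    rw [if_neg hk] at h
    exact h.symm

end Eigenvectors

/-! ### Deformation to the diagonal case -/

section Perturbation

variable {R ι : Type*} [Ring R] {𝓡 : ZMod 2 → AddSubgroup R} [GradedRing 𝓡] [SuperCommutative 𝓡]
  [Fintype ι] [LinearOrder ι] {π : ι → ZMod 2}

/-- The sequence of traces of exterior powers of the operator with matrix `a`. -/
noncomputable def traceSeq (h2 : IsUnit (2 : R)) (a : Matrix ι ι R)
    (ha : ∀ x y, a x y ∈ 𝓡 (π x + π y)) (k : ℤ) : evenPart 𝓡 :=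
  if 0 ≤ k then ⟨ExteriorAlg.matrixExteriorTrace 𝓡 π a k.toNat,
    matrixExteriorTrace_mem 𝓡 π h2 a ha k.toNat⟩
  else 0

omit [GradedRing 𝓡] [SuperCommutative 𝓡] in
theorem ofPowerSeries_mem {i : ZMod 2} {f : PowerSeries R}
    (hf : ∀ n, PowerSeries.coeff n f ∈ 𝓡 i) :
    HahnSeries.ofPowerSeries ℤ R f ∈ laurentParity 𝓡 i := by
  intro n
  rw [HahnSeries.ofPowerSeries_apply]
  by_cases hn : n ∈ Set.range (Nat.cast : ℕ → ℤ)
  · obtain ⟨m, rfl⟩ := hn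
    rw [← HahnSeries.ofPowerSeries_apply, HahnSeries.ofPowerSeries_apply_coeff]
    exact hf m
  · rw [HahnSeries.embDomain_of_notMem_range]
    · exact zero_mem _
    · exact hn

/-- The matrix `a` perturbed by a diagonal matrix of poles of orders `e`. -/
noncomputable def poleMatrix (a : Matrix ι ι R) (e : ι → ℕ) : Matrix ι ι (HahnSeries ℤ R) :=
  a.map HahnSeries.C + Matrix.diagonal fun x => HahnSeries.single (-e x : ℤ) 1

omit [SuperCommutative 𝓡] [Fintype ι] in
theorem poleMatrix_mem {a : Matrix ι ι R} (ha : ∀ x y, a x y ∈ 𝓡 (π x + π y)) (e : ι → ℕ)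
    (x y : ι) : poleMatrix a e x y ∈ laurentParity 𝓡 (π x + π y) := by
  rw [poleMatrix, Matrix.add_apply, Matrix.map_apply, Matrix.diagonal_apply]
  refine add_mem (single_mem_laurentParity 𝓡 (ha x y) 0) ?_
  split_ifs with h
  · rw [h, parity_add_self]
    exact single_mem_laurentParity 𝓡 SetLike.GradedOne.one_mem _
  · exact zero_mem _

/-- The basis of coordinate vectors consisting of the rows of an invertible matrix. -/
noncomputable def rowBasis {S : Type*} [Ring S] (P Q : Matrix ι ι S) (hPQ : P * Q = 1)
    (hQP : Q * P = 1) : Module.Basis ι S (ι → S) :=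
  (Pi.basisFun S ι).map <| LinearEquiv.ofLinearMap P.vecMulLinear Q.vecMulLinear
    (LinearMap.ext fun v => by
      simp [Matrix.vecMul_vecMul, hQP])
    (LinearMap.ext fun v => by
      simp [Matrix.vecMul_vecMul, hPQ])

theorem rowBasis_apply {S : Type*} [Ring S] (P Q : Matrix ι ι S) (hPQ : P * Q = 1)
    (hQP : Q * P = 1) (i : ι) : rowBasis P Q hPQ hQP i = P i := by
  rw [rowBasis, Module.Basis.map_apply, Pi.basisFun_apply]
  exact Matrix.single_one_vecMul i P

/-- With `s i k = (P a) i k` and the normalisation `P i i = 1`, coordinate `i` of the eigenvector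
equation gives the eigenvalue as the pole plus `s i i`. Coordinate `k ≠ i`, divided by the
difference of the poles at `k` and `i`, is the fixed-point equation solved above. The matrix `P` of
eigenvectors is the identity at order zero, hence invertible. -/
theorem poleMatrix_diagonalizable (a : Matrix ι ι R)
    (ha : ∀ x y, a x y ∈ 𝓡 (π x + π y)) (e : ι → ℕ) (he : Function.Injective e)
    (hpos : ∀ x, 0 < e x) :
    ∃ (b : Module.Basis ι (HahnSeries ℤ R) (ι → HahnSeries ℤ R))
      (θ : ι → evenPart (laurentParity 𝓡)),
      IsHomogBasis (laurentParity 𝓡) (piParity (laurentParity 𝓡) π) b π ∧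
      ∀ i, (poleMatrix a e).vecMulLinear (b i) = (θ i : HahnSeries ℤ R) • b i := by
  have hg : ∀ i k, ∃ g : PowerSeries ℤ, PowerSeries.coeff 0 g = 0 ∧ (k ≠ i →
      g * (PowerSeries.X ^ e i - PowerSeries.X ^ e k) = PowerSeries.X ^ (e i + e k)) := by
    intro i k
    by_cases hk : k = i
    · exact ⟨0, map_zero _, fun h => absurd hk h⟩
    · obtain ⟨g, hg0, hg⟩ := exists_inverse_difference (hpos i) (hpos k)
        fun h => hk (he h).symm
      exact ⟨g, hg0, fun _ => hg⟩
  choose g hg0 hg using hg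
  choose P hP1 hPmem hP using fun i => exists_perturbed_eigenvector a ha i (g i) (hg0 i)
  have hPcoeff : ∀ x y, PowerSeries.coeff 0 ((Matrix.of P) x y) = (1 : Matrix ι ι R) x y := by
    intro x y
    rw [Matrix.of_apply, Matrix.one_apply]
    split_ifs with h
    · rw [← h, hP1, PowerSeries.coeff_zero_one]
    · rw [hP x y (Ne.symm h), PowerSeries.coeff_mul, Finset.Nat.antidiagonal_zero,
        Finset.sum_singleton, PowerSeries.coeff_map, hg0, map_zero, zero_mul]
  obtain ⟨Q, hPQ, hQP⟩ := isUnit_of_coeff_zero (Matrix.of P) hPcoeff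
  let Φ := HahnSeries.ofPowerSeries ℤ R
  have hPQ' : (Matrix.of P).map Φ * Q.map Φ = 1 := by
    rw [← Matrix.map_mul, hPQ, Matrix.map_one _ (map_zero Φ) (map_one Φ)]
  have hQP' : Q.map Φ * (Matrix.of P).map Φ = 1 := by
    rw [← Matrix.map_mul, hQP, Matrix.map_one _ (map_zero Φ) (map_one Φ)]
  let s : ι → ι → PowerSeries R := fun i k => ∑ j, P i j * PowerSeries.C (a j k)
  have hs : ∀ i n, PowerSeries.coeff n (s i i) ∈ 𝓡 0 := by
    intro i n
    rw [map_sum]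
    refine AddSubgroup.sum_mem _ fun j _ => ?_
    rw [PowerSeries.coeff_mul_C]
    have h := SetLike.GradedMul.mul_mem (hPmem i j n) (ha j i)
    rwa [← add_assoc, parity_add_cancel, parity_add_self] at h
  let τ : ℤ → HahnSeries ℤ R := fun n => HahnSeries.single n 1
  have hτ : ∀ m n, τ m * τ n = τ (m + n) := by
    intro m n
    simp [τ, HahnSeries.single_mul_single]
  have hτmem : ∀ n, τ n ∈ laurentParity 𝓡 0 := fun n =>
    single_mem_laurentParity 𝓡 SetLike.GradedOne.one_mem n
  have hτX : ∀ n : ℕ, Φ (PowerSeries.X ^ n) = τ n := by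
    intro n
    rw [map_pow, HahnSeries.ofPowerSeries_X, HahnSeries.single_pow, one_pow]
    simp [τ]
  refine ⟨rowBasis _ _ hPQ' hQP', fun i => ⟨τ (-e i) + Φ (s i i),
    add_mem (hτmem _) (ofPowerSeries_mem (hs i))⟩, ?_, ?_⟩
  · refine (isHomogBasis_basisFun (laurentParity 𝓡) π).of_mem _ _ fun i k => ?_
    rw [rowBasis_apply]
    exact ofPowerSeries_mem (hPmem i k)
  · intro i
    rw [rowBasis_apply]
    funext k
    change ∑ j, Φ (P i j) * poleMatrix a e j k = (τ (-e i) + Φ (s i i)) * Φ (P i k)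
    have hlhs : ∑ j, Φ (P i j) * poleMatrix a e j k = Φ (s i k) + Φ (P i k) * τ (-e k) := by
      simp only [poleMatrix, Matrix.add_apply, Matrix.map_apply, mul_add, Finset.sum_add_distrib]
      congr 1
      · rw [map_sum]
        refine Finset.sum_congr rfl fun j _ => ?_
        rw [map_mul, HahnSeries.ofPowerSeries_C]
      · rw [Finset.sum_eq_single k]
        · rw [Matrix.diagonal_apply_eq]
        · intro j _ hj
          rw [Matrix.diagonal_apply_ne _ hj, mul_zero]
        · exact fun h => absurd (Finset.mem_univ k) h
    rw [hlhs]
    by_cases hk : k = i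
    · rw [hk, hP1, map_one, one_mul, mul_one, add_comm]
    · set p := Φ (P i k) with hp
      set γ := Φ (PowerSeries.map (Int.castRingHom R) (g i k)) with hγ
      have hpeq : p = γ * (p * Φ (s i i) - Φ (s i k)) := by
        have h := congrArg Φ (hP i k hk)
        rw [map_mul, map_sub, map_mul] at h
        exact h
      have hγeq : γ * (τ (e i) - τ (e k)) = τ (e i + e k) := by
        have h := congrArg (fun f => Φ (PowerSeries.map (Int.castRingHom R) f)) (hg i k hk)
        simp only [map_mul, map_sub, map_pow, PowerSeries.map_X] at h
        rw [← map_pow, ← map_pow, ← map_pow, hτX, hτX, hτX] at h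
        rw [hγ, h, Nat.cast_add]
      -- Multiplying `hγeq` by `τ (-e i - e k)` turns `γ` into the inverse of the difference of the
      -- poles.
      have hγinv : (τ (-e k) - τ (-e i)) * γ = 1 := by
        have h := congrArg (· * τ (-e i + -e k)) hγeq
        simp only [mul_assoc, sub_mul, hτ] at h
        rw [even_mul_comm (laurentParity 𝓡) (sub_mem (hτmem _) (hτmem _))]
        have e1 : (e i : ℤ) + (-e i + -e k) = -e k := by ring
        have e2 : (e k : ℤ) + (-e i + -e k) = -e i := by ring
        have e3 : (e i : ℤ) + e k + (-e i + -e k) = 0 := by ring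
        rw [e1, e2, e3] at h
        exact h
      have h := congrArg ((τ (-e k) - τ (-e i)) * ·) hpeq
      simp only [← mul_assoc, hγinv, one_mul] at h
      rw [sub_mul, even_mul_comm (laurentParity 𝓡) (hτmem (-e k))] at h
      -- The fixed-point equation has `s i i` to the right of `p` and the eigenvector equation to
      -- its left; they agree because `s i i` is even.
      rw [add_mul, even_mul_comm (laurentParity 𝓡) (ofPowerSeries_mem (hs i)) p, add_comm,
        add_comm (τ _ * p)]
      exact sub_eq_sub_iff_add_eq_add.1 h

theorem isUnit_two_of_ringHom {S : Type*} [Ring S] (φ : R →+* S) (h2 : IsUnit (2 : R)) :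
    IsUnit (2 : S) := by
  have h := h2.map φ
  rwa [map_ofNat] at h

theorem hankel_det_poleMatrix (h2 : IsUnit (2 : HahnSeries ℤ R)) (a : Matrix ι ι R)
    (ha : ∀ x y, a x y ∈ 𝓡 (π x + π y)) (e : ι → ℕ) (he : Function.Injective e)
    (hpos : ∀ x, 0 < e x) {p q : ℕ} (hp : (Finset.univ.filter fun x => π x = 0).card = p)
    (hq : (Finset.univ.filter fun x => π x ≠ 0).card = q) {k : ℤ} (hk : (p : ℤ) - q < k) :
    (Matrix.of fun i j : Fin (q + 1) =>
      traceSeq h2 (poleMatrix a e) (poleMatrix_mem ha e) (k + (i : ℕ) + (j : ℕ))).det = 0 := by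
  obtain ⟨b, θ, hb, hθ⟩ := poleMatrix_diagonalizable a ha e he hpos
  refine ExteriorAlg.hankel_det_eq_zero_of_eigenbasis b h2 hb
    (matrixOperator (poleMatrix a e) (poleMatrix_mem ha e)) θ hθ _ ?_ ?_ hp hq hk
  · intro k hk
    rw [traceSeq, if_neg (not_le.2 hk)]
  · intro n
    rw [traceSeq, if_pos (Int.natCast_nonneg n), supertrace_matrixOperator _ _ h2]
    rfl

/-- The map on even parts induced by a parity preserving ring homomorphism. -/
noncomputable def evenPartMap {S : Type*} [Ring S] {𝓢 : ZMod 2 → AddSubgroup S} [GradedRing 𝓢]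
    [SuperCommutative 𝓢] (φ : R →+* S) (hφ : ∀ i, ∀ a ∈ 𝓡 i, φ a ∈ 𝓢 i) :
    evenPart 𝓡 →+* evenPart 𝓢 where
  toFun a := ⟨φ (a : R), hφ 0 a a.2⟩
  map_one' := Subtype.ext (map_one φ)
  map_mul' a b := Subtype.ext (map_mul φ (a : R) b)
  map_zero' := Subtype.ext (map_zero φ)
  map_add' a b := Subtype.ext (map_add φ (a : R) b)

theorem evenPartMap_traceSeq {S : Type*} [Ring S] {𝓢 : ZMod 2 → AddSubgroup S} [GradedRing 𝓢]
    [SuperCommutative 𝓢] (φ : R →+* S) (hφ : ∀ i, ∀ a ∈ 𝓡 i, φ a ∈ 𝓢 i) (h2 : IsUnit (2 : R))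
    (h2' : IsUnit (2 : S)) {a : Matrix ι ι R} (ha : ∀ x y, a x y ∈ 𝓡 (π x + π y))
    {a' : Matrix ι ι S} (ha' : ∀ x y, a' x y ∈ 𝓢 (π x + π y)) (h : ∀ x y, φ (a x y) = a' x y)
    (k : ℤ) : evenPartMap φ hφ (traceSeq h2 a ha k) = traceSeq h2' a' ha' k := by
  by_cases hk : 0 ≤ k
  · rw [traceSeq, traceSeq, if_pos hk, if_pos hk]
    refine Subtype.ext ((ExteriorAlg.map_matrixExteriorTrace 𝓡 𝓢 π φ hφ a k.toNat).trans ?_)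
    simp only [h]
  · rw [traceSeq, traceSeq, if_neg hk, if_neg hk, map_zero]

/-- The deformation `a + diag(X^e)` over `R[X]` links both ends: at `X = 0` it is `a`, since all `e
x` are positive, and in Laurent series in `X⁻¹` it is the diagonalisable `poleMatrix a e`. -/
theorem hankel_det_traceSeq (h2 : IsUnit (2 : R)) (a : Matrix ι ι R)
    (ha : ∀ x y, a x y ∈ 𝓡 (π x + π y)) (e : ι → ℕ) (he : Function.Injective e)
    (hpos : ∀ x, 0 < e x) {p q : ℕ} (hp : (Finset.univ.filter fun x => π x = 0).card = p)
    (hq : (Finset.univ.filter fun x => π x ≠ 0).card = q) {k : ℤ} (hk : (p : ℤ) - q < k) :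
    (Matrix.of fun i j : Fin (q + 1) =>
      traceSeq h2 a ha (k + (i : ℕ) + (j : ℕ))).det = 0 := by
  have h2P : IsUnit (2 : Polynomial R) := isUnit_two_of_ringHom Polynomial.C h2
  have h2L : IsUnit (2 : HahnSeries ℤ R) := isUnit_two_of_ringHom HahnSeries.C h2
  let aP : Matrix ι ι (Polynomial R) :=
    a.map Polynomial.C + Matrix.diagonal fun x => Polynomial.X ^ e x
  have haP : ∀ x y, aP x y ∈ polyParity 𝓡 (π x + π y) := by
    intro x y
    simp only [aP, Matrix.add_apply, Matrix.map_apply, Matrix.diagonal_apply]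
    refine add_mem (monomial_mem_polyParity 𝓡 (ha x y) 0) ?_
    split_ifs with h
    · rw [h, parity_add_self, Polynomial.X_pow_eq_monomial]
      exact monomial_mem_polyParity 𝓡 SetLike.GradedOne.one_mem _
    · exact zero_mem _
  have hev : ∀ i, ∀ f ∈ polyParity 𝓡 i, Polynomial.constantCoeff f ∈ 𝓡 i := fun i f hf => hf 0
  have hL : ∀ i, ∀ f ∈ polyParity 𝓡 i, polyToLaurent R f ∈ laurentParity 𝓡 i :=
    fun i f hf => polyToLaurent_mem 𝓡 hf
  have h0 : ∀ x y, Polynomial.constantCoeff (aP x y) = a x y := by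
    intro x y
    simp only [aP, Matrix.add_apply, Matrix.map_apply, Matrix.diagonal_apply, map_add]
    split_ifs <;> simp [(hpos x).ne]
  have hLa : ∀ x y, polyToLaurent R (aP x y) = poleMatrix a e x y := by
    intro x y
    simp only [aP, poleMatrix, Matrix.add_apply, Matrix.map_apply, Matrix.diagonal_apply, map_add]
    congr 1
    · exact polyToLaurent_monomial 0 (a x y)
    · split_ifs
      · rw [Polynomial.X_pow_eq_monomial, polyToLaurent_monomial]
      · exact map_zero _
  have hdet : (Matrix.of fun i j : Fin (q + 1) =>
      traceSeq h2P aP haP (k + (i : ℕ) + (j : ℕ))).det = 0 := by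
    have hinj : Function.Injective (evenPartMap (polyToLaurent R) hL) := fun f g h =>
      Subtype.ext (polyToLaurent_injective (congrArg Subtype.val h))
    -- The vanishing descends to `R[X]` because the embedding into Laurent series is injective on
    -- even parts.
    refine hinj ?_
    rw [RingHom.map_det, map_zero, ← hankel_det_poleMatrix h2L a ha e he hpos hp hq hk]
    congr 1
    ext1 i j
    exact evenPartMap_traceSeq _ hL h2P h2L haP (poleMatrix_mem ha e) hLa _
  rw [← map_zero (evenPartMap Polynomial.constantCoeff hev), ← hdet, RingHom.map_det]
  congr 1
  ext1 i j
  exact (evenPartMap_traceSeq _ hev h2P h2 haP ha h0 _).symm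

end Perturbation

theorem SuperBasis.isHomogBasis {R V : Type*} [Ring R] [AddCommGroup V] [Module R V]
    {𝓡 : ZMod 2 → AddSubgroup R} [GradedRing 𝓡] {𝓥 : ZMod 2 → AddSubgroup V}
    [DirectSum.Decomposition 𝓥] [SetLike.GradedSMul 𝓡 𝓥] {p q : ℕ} (B : SuperBasis R 𝓥 p q) :
    IsHomogBasis 𝓡 𝓥 B.basis (Sum.elim (fun _ => 0) fun _ => 1) := by
  refine isHomogBasis_of_mem _ _ ?_ ?_ ?_
  · rintro (x | x)
    · exact B.even_mem x
    · exact B.odd_mem x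
  · intro i j a v ha hv
    exact SetLike.GradedSMul.smul_mem ha hv
  · intro j v hv hv'
    exact eq_zero_of_mem_of_mem 𝓥 (i := j) (j := j + 1) (by simp) hv hv'

theorem IsHomogBasis.reindex {R V ι κ : Type*} [Ring R] [AddCommGroup V] [Module R V]
    {𝓡 : ZMod 2 → AddSubgroup R} {𝓥 : ZMod 2 → AddSubgroup V} {b : Module.Basis ι R V}
    {π : ι → ZMod 2} (hb : IsHomogBasis 𝓡 𝓥 b π) (e : ι ≃ κ) :
    IsHomogBasis 𝓡 𝓥 (b.reindex e) (π ∘ e.symm) := by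
  intro j v
  rw [hb]
  simp only [Module.Basis.repr_reindex_apply, Function.comp_apply]
  exact e.symm.surjective.forall

end SuperLA

theorem mainTheorem5 {R : Type*} [Ring R] (h2 : IsUnit (2 : R))
    (𝓡 : ZMod 2 → AddSubgroup R) [GradedRing 𝓡] [SuperLA.SuperCommutative 𝓡]
    {V : Type*} [AddCommGroup V] [Module R V]
    (𝓥 : ZMod 2 → AddSubgroup V) [DirectSum.Decomposition 𝓥] [SetLike.GradedSMul 𝓡 𝓥]
    (p q : ℕ) (hV : SuperLA.HasSuperDim R 𝓥 p q) (A : SuperLA.EvenOperator R 𝓥) :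
    ∃ c : ℤ → SuperLA.evenPart 𝓡,
      (∀ k : ℤ, (c k : R) = SuperLA.exteriorTrace 𝓡 A k) ∧
      ∀ k : ℤ, (p : ℤ) - (q : ℤ) < k →
        (Matrix.of fun i j : Fin (q + 1) => c (k + (i : ℕ) + (j : ℕ))).det = 0 := by
  obtain ⟨B⟩ := hV
  -- Sorted words need a linear order on the index set, which `Fin (p + q)` provides.
  have hb := (B.isHomogBasis (𝓡 := 𝓡)).reindex finSumFinEquiv
  set b := B.basis.reindex finSumFinEquiv
  set π : Fin (p + q) → ZMod 2 :=
    Sum.elim (fun _ : Fin p => 0) (fun _ : Fin q => 1) ∘ finSumFinEquiv.symm with hπ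
  let a : Matrix (Fin (p + q)) (Fin (p + q)) R :=
    Matrix.of fun x y => b.repr (A.toLin (b x)) y
  have ha : ∀ x y, a x y ∈ 𝓡 (π x + π y) := fun x y =>
    (hb _ _).1 (A.map_mem (hb.mem x)) y
  have hcard : ∀ P : ZMod 2 → Prop, ∀ [DecidablePred P],
      (Finset.univ.filter fun x => P (π x)).card =
        (Finset.univ.filter fun x : Fin p ⊕ Fin q =>
          P (Sum.elim (fun _ => 0) (fun _ => 1) x)).card := by
    intro P _
    refine Finset.card_equiv finSumFinEquiv.symm fun x => ?_
    simp [hπ]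
  have hp : (Finset.univ.filter fun x => π x = 0).card = p := by
    rw [hcard fun i => i = 0, Finset.card_filter, Fintype.sum_sum_type]
    simp
  have hq : (Finset.univ.filter fun x => π x ≠ 0).card = q := by
    rw [hcard fun i => i ≠ 0, Finset.card_filter, Fintype.sum_sum_type]
    simp
  refine ⟨SuperLA.traceSeq h2 a ha, fun k => ?_, fun k hk =>
    -- Any distinct positive exponents serve; the shift by one keeps the deformation trivial at `X =
    -- 0`.
    SuperLA.hankel_det_traceSeq h2 a ha (fun x => (x : ℕ) + 1)
      (fun x y h => Fin.ext (Nat.succ_injective h)) (fun x => Nat.succ_pos _) hp hq hk⟩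
  rw [SuperLA.traceSeq, SuperLA.exteriorTrace]
  split_ifs
  · exact (SuperLA.ExteriorAlg.supertrace_powerMap h2 hb A k.toNat).symm
  · rfl
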